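/- Let $p\ge 7$ be a prime. Define the Apéry numbers by $b_0=1$, $b_1=5$ and \[ b_n=\frac{34n^3-51n^2+27n-5}{n^3}\,b_{n-1}-\frac{(n-1)^3}{n^3}\,b_{n-2}\qquad(n\ge 2). \] For an integer $k\ge 2$ let $\zeta_p(k)\in\mathbb{Q}_p$ be the $p$-adic zeta value \[ \zeta_p(k)=\lim_{\substack{n\to-\infty\\ n\equiv k \bmod (p-1)\\ n\to k\ p\text{-adically}}}(1-p^{-n})\,\zeta(n), \] where $n$ runs through negative integers, at which the Riemann zeta function $\zeta$ takes rational values. Then the limits defining $\zeta_p(3)$, $\zeta_p(5)$, $\zeta_p(7)$ exist, and \[ b_{p-1}\equiv 1+2p^3\zeta_p(3)-16p^5\zeta_p(5)+4p^6\zeta_p(3)^2-100p^7\zeta_p(7)\pmod{p^8}, \] that is, the difference of the two sides lies in $p^8\mathbb{Z}_p$. -/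

import Mathlib

open Filter Topology

noncomputable section

/-- The Apéry numbers `b n`, given by Apéry's recurrence with `b 0 = 1`, `b 1 = 5`.
The third clause is the recurrence at the index `m = n + 2`. -/
def aperyB : ℕ → ℚ
  | 0 => 1
  | 1 => 5
  | (n + 2) =>
      let m : ℚ := (n : ℚ) + 2
      (34 * m ^ 3 - 51 * m ^ 2 + 27 * m - 5) / m ^ 3 * aperyB (n + 1)
        - (m - 1) ^ 3 / m ^ 3 * aperyB n

/-- The rational number `ζ(n)` for an integer `n ≤ 0` (see `riemannZeta_eq_zetaNonpos`). -/
def zetaNonpos (n : ℤ) : ℚ :=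
  (-1) ^ (-n).toNat * bernoulli ((-n).toNat + 1) / ((-n).toNat + 1)

theorem riemannZeta_eq_zetaNonpos (n : ℤ) (hn : n ≤ 0) :
    riemannZeta (n : ℂ) = ((zetaNonpos n : ℚ) : ℂ) := by
  obtain ⟨m, rfl⟩ : ∃ m : ℕ, n = -(m : ℤ) := ⟨(-n).toNat, by omega⟩
  have h := riemannZeta_neg_nat_eq_bernoulli m
  simp only [zetaNonpos, neg_neg, Int.toNat_natCast]
  push_cast
  exact h

/-- The mode of convergence `n → -∞`, `n ≡ k mod (p - 1)`, `n → k` `p`-adically,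
for integers `n`. -/
def padicZetaFilter (p : ℕ) [Fact p.Prime] (k : ℤ) : Filter ℤ :=
  atBot ⊓ 𝓟 {n : ℤ | n ≡ k [ZMOD ((p : ℤ) - 1)]} ⊓
    comap (fun n : ℤ => (n : ℚ_[p])) (𝓝 (k : ℚ_[p]))

/-- The value at `n ≤ 0` of the zeta function with its Euler factor at `p` removed,
`(1 - p ^ (-n)) ζ(n)`, as a `p`-adic number. -/
def eulerRemovedZeta (p : ℕ) [Fact p.Prime] (n : ℤ) : ℚ_[p] :=
  (1 - (p : ℚ_[p]) ^ (-n)) * ((zetaNonpos n : ℚ) : ℚ_[p])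

/-- The `p`-adic zeta value `ζ_p(k)`, the limit of `(1 - p ^ (-n)) ζ(n)` along
`padicZetaFilter p k`. -/
def padicZeta (p : ℕ) [Fact p.Prime] (k : ℤ) : ℚ_[p] :=
  limUnder (padicZetaFilter p k) (eulerRemovedZeta p)

/-- The limit process is not vacuous, so limits along it are unique. -/
theorem padicZetaFilter_neBot (p : ℕ) [Fact p.Prime] (k : ℤ) :
    (padicZetaFilter p k).NeBot := by
  have hp : 2 ≤ p := (Fact.out : p.Prime).two_le
  have key : Tendsto (fun r : ℕ => k - ((p : ℤ) - 1) * (p : ℤ) ^ r) atTop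
      (padicZetaFilter p k) := by
    refine tendsto_inf.2 ⟨tendsto_inf.2 ⟨?_, ?_⟩, ?_⟩
    · refine tendsto_atBot.2 fun b => ?_
      filter_upwards [eventually_ge_atTop (k - b).toNat] with r hr
      have h1 : (r : ℤ) < (p : ℤ) ^ r := by exact_mod_cast Nat.lt_pow_self (by omega)
      have h2 : (p : ℤ) ^ r ≤ ((p : ℤ) - 1) * (p : ℤ) ^ r :=
        le_mul_of_one_le_left (by positivity) (by omega)
      omega
    · refine tendsto_principal.2 (Eventually.of_forall fun r => ?_)
      refine (Int.modEq_iff_dvd.2 ?_)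
      exact ⟨(p : ℤ) ^ r, by ring⟩
    · refine tendsto_comap_iff.2 ?_
      have h0 : Tendsto (fun r : ℕ => (p : ℚ_[p]) ^ r) atTop (𝓝 0) :=
        tendsto_pow_atTop_nhds_zero_of_norm_lt_one Padic.norm_p_lt_one
      have h1 := (h0.const_mul ((p : ℚ_[p]) - 1)).const_sub (k : ℚ_[p])
      simp only [mul_zero, sub_zero] at h1
      refine h1.congr fun r => ?_
      simp
  exact key.neBot

/-- `x ≡ y mod p ^ n` for `p`-adic numbers: `x - y ∈ p ^ n ℤ_p`. -/
def PadicCongr (p : ℕ) [Fact p.Prime] (n : ℕ) (x y : ℚ_[p]) : Prop :=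
  ∃ z : ℤ_[p], x - y = (p : ℚ_[p]) ^ n * (z : ℚ_[p])

end

/-! Put `y_k = p / k`, `c_k = (-1)^k C(p-1,k) C(p-1+k,k)` and `H_s = ∑_{0<k<p} y_k ^ s`. Creative
telescoping gives `b_{p-1} = 1 + ∑ c_k ^ 2`, and `(1 + y_k) c_k = y_k ∏_{j ≤ k} (1 - y_j ^ 2)`.
Modulo `p ^ 8` the product may be truncated, so `∑ c_k ^ 2` becomes a combination of the `H_s` and
of nested sums such as `∑ y_k ^ a A_k`, where `A_k = ∑_{j ≤ k} y_j ^ 2`.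

The nested sums are removed by three devices. Symmetric ones reduce by quasi-shuffle identities. The
reversal `k ↦ p - k`, under which `y_k` becomes `-(y_k + y_k ^ 2 + ⋯)`, expresses odd power sums by
even ones and evaluates `∑ y_k ^ 3 A_k ^ 2`. Finally, the `c_k` are the residues in the partial
fraction expansion of `∏ (j - t) / (t ∏ (j + t))`, so the moments `∑ c_k y_k ^ m` are known in terms
of power sums; expanding the same moments by truncation determines the remaining nested sums. The
outcome, `sum_sq_eq_powerSums`, is `b_{p-1} ≡ 1 + H_2 - 5 H_4 - H_6 + H_2 ^ 2`.

For the zeta values, let `N = (p - 1) p ^ r`. Then `k ^ (N - s) → k ^ (-s)` `p`-adically, while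
Faulhaber's formula writes `∑ k ^ (N - s)` through Bernoulli numbers `B_{N-s-t}`, which tend to `(s
+ t) ζ_p(s + t + 1)`. Terms with `s + t ≥ 8` are negligible by von Staudt–Clausen, and those with
`t` odd vanish. Existence of the `ζ_p(k)` follows from Kummer congruences, proved by letting
multiplication by `c = 1 + p` permute the residues prime to `p` and recording the carries.
Substituting, the coefficient of `p ^ 5 ζ_p(5)` is `4 - 5 * 4 = -16` and that of `p ^ 7 ζ_p(7)` is
`6 - 5 * 20 - 6 = -100`. -/

/-! ### Closed form of the Apéry numbers by creative telescoping -/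

/-- The factor `C(n,k) C(n+k,k)` of the summand of the Apéry numbers. -/
def aperyTerm (n k : ℕ) : ℕ := n.choose k * (n + k).choose k

theorem aperyTerm_eq_zero {n k : ℕ} (h : n < k) : aperyTerm n k = 0 := by
  simp [aperyTerm, Nat.choose_eq_zero_of_lt h]

theorem aperyTerm_zero_right (n : ℕ) : aperyTerm n 0 = 1 := by simp [aperyTerm]

theorem aperyTerm_add (m k : ℕ) :
    (aperyTerm (m + k) k : ℚ) =
      ((m + 2 * k).factorial : ℚ) / (m.factorial * (k.factorial : ℚ) ^ 2) := by
  rw [aperyTerm, Nat.cast_mul, Nat.cast_choose ℚ (Nat.le_add_left k m),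
    Nat.cast_choose ℚ (Nat.le_add_left k (m + k)), Nat.add_sub_cancel, Nat.add_sub_cancel,
    show m + k + k = m + 2 * k by ring]
  have h1 : ((m + k).factorial : ℚ) ≠ 0 := by positivity
  have h2 : (m.factorial : ℚ) ≠ 0 := by positivity
  have h3 : (k.factorial : ℚ) ≠ 0 := by positivity
  field_simp

/-- The contiguity relation of `aperyTerm` in its second argument. -/
theorem aperyTerm_succ_right (n k : ℕ) :
    ((k : ℚ) + 1) ^ 2 * aperyTerm n (k + 1) = ((n : ℚ) - k) * (n + k + 1) * aperyTerm n k := by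
  rcases lt_trichotomy n k with h | rfl | h
  · simp [aperyTerm_eq_zero h, aperyTerm_eq_zero (h.trans (Nat.lt_succ_self k))]
  · simp [aperyTerm_eq_zero (Nat.lt_succ_self n)]
  · obtain ⟨m, rfl⟩ : ∃ m, n = m + (k + 1) := ⟨n - (k + 1), by omega⟩
    rw [aperyTerm_add, show m + (k + 1) = (m + 1) + k by ring, aperyTerm_add,
      show m + 2 * (k + 1) = (m + 1 + 2 * k) + 1 by ring, Nat.factorial_succ (m + 1 + 2 * k),
      Nat.factorial_succ m, Nat.factorial_succ k]
    have h2 : (m.factorial : ℚ) ≠ 0 := by positivity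
    have h3 : (k.factorial : ℚ) ≠ 0 := by positivity
    push_cast
    have : (m : ℚ) + 1 ≠ 0 := by positivity
    have : (k : ℚ) + 1 ≠ 0 := by positivity
    field_simp
    ring

theorem aperyTerm_succ_left (n k : ℕ) :
    ((n : ℚ) + 1 - k) * aperyTerm (n + 1) k = ((n : ℚ) + 1 + k) * aperyTerm n k := by
  rcases lt_trichotomy k (n + 1) with h | rfl | h
  · obtain ⟨m, rfl⟩ : ∃ m, n = m + k := ⟨n - k, by omega⟩
    rw [aperyTerm_add, show m + k + 1 = (m + 1) + k by ring, aperyTerm_add,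
      show m + 1 + 2 * k = (m + 2 * k) + 1 by ring, Nat.factorial_succ (m + 2 * k),
      Nat.factorial_succ m]
    have h2 : (m.factorial : ℚ) ≠ 0 := by positivity
    have h3 : (k.factorial : ℚ) ≠ 0 := by positivity
    push_cast
    have : (m : ℚ) + 1 ≠ 0 := by positivity
    field_simp
    ring
  · simp [aperyTerm_eq_zero (Nat.lt_succ_self n)]
  · simp [aperyTerm_eq_zero h, aperyTerm_eq_zero (Nat.lt_of_succ_lt h)]

/-- Zeilberger's certificate for the sum of the squares of `aperyTerm`. -/
def aperyCert (n k : ℕ) : ℚ :=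
  4 * (2 * (n + 1) + 1) * (k * (2 * k + 1) - (2 * (n + 1) + 1) ^ 2) *
    (aperyTerm (n + 1) k : ℚ) ^ 2

/-- The Apéry recurrence operator applied to the summand. -/
def aperyOp (n k : ℕ) : ℚ :=
  ((n : ℚ) + 2) ^ 3 * (aperyTerm (n + 2) k : ℚ) ^ 2
    - (34 * ((n : ℚ) + 2) ^ 3 - 51 * ((n : ℚ) + 2) ^ 2 + 27 * ((n : ℚ) + 2) - 5)
      * (aperyTerm (n + 1) k : ℚ) ^ 2
    + ((n : ℚ) + 1) ^ 3 * (aperyTerm n k : ℚ) ^ 2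

theorem aperyOp_zero (n : ℕ) : aperyOp n 0 = aperyCert n 0 := by
  simp only [aperyOp, aperyCert, aperyTerm_zero_right]
  push_cast
  ring

/-- The contiguity relations express every term as a rational multiple of one reference term,
usually `aperyTerm (n + 1) (k + 1)`, which reduces the claim to an identity of rational functions.
The reference vanishes for `k > n`, so the edge of the support is treated separately. -/
theorem aperyOp_succ (n k : ℕ) :
    aperyOp n (k + 1) = aperyCert n (k + 1) - aperyCert n k := by
  have e1 := aperyTerm_succ_left n (k + 1)
  have e2 := aperyTerm_succ_left (n + 1) (k + 1)
  have e3 := aperyTerm_succ_right (n + 1) k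
  push_cast at e1 e2 e3
  simp only [aperyOp, aperyCert]
  push_cast
  rcases lt_trichotomy k n with h | rfl | h
  · have h1 : (n : ℚ) - k ≠ 0 := sub_ne_zero.2 (by exact_mod_cast h.ne')
    have h2 : (n : ℚ) + 1 - k ≠ 0 := by
      have : (k : ℚ) < n := by exact_mod_cast h
      linarith
    have h3 : (n : ℚ) + k + 2 ≠ 0 := by positivity
    have f0 : (aperyTerm n (k + 1) : ℚ) =
        (n - k) / (n + k + 2) * aperyTerm (n + 1) (k + 1) := by
      field_simp; linear_combination -e1
    have f2 : (aperyTerm (n + 2) (k + 1) : ℚ) =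
        (n + k + 3) / (n + 1 - k) * aperyTerm (n + 1) (k + 1) := by
      field_simp; linear_combination e2
    have f1 : (aperyTerm (n + 1) k : ℚ) =
        (k + 1) ^ 2 / ((n + 1 - k) * (n + k + 2)) * aperyTerm (n + 1) (k + 1) := by
      field_simp; linear_combination -e3
    rw [f0, f1, f2]
    field_simp
    ring
  · have f0 : (aperyTerm k (k + 1) : ℚ) = 0 := by
      simp [aperyTerm_eq_zero (Nat.lt_succ_self k)]
    have f2 : (aperyTerm (k + 2) (k + 1) : ℚ) = (2 * k + 3) * aperyTerm (k + 1) (k + 1) := by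
      linear_combination e2
    have f1 : (aperyTerm (k + 1) k : ℚ) = (k + 1) / 2 * aperyTerm (k + 1) (k + 1) := by
      have : (k : ℚ) + 1 ≠ 0 := by positivity
      refine mul_left_cancel₀ this ?_
      linear_combination -e3 / 2
    rw [f0, f1, f2]
    ring
  · have f0 : (aperyTerm n (k + 1) : ℚ) = 0 := by
      simp [aperyTerm_eq_zero (show n < k + 1 by omega)]
    have f1 : (aperyTerm (n + 1) (k + 1) : ℚ) = 0 := by
      simp [aperyTerm_eq_zero (show n + 1 < k + 1 by omega)]
    rcases (show n + 1 ≤ k from h).eq_or_lt with rfl | h'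
    -- At `k = n + 1` only `aperyTerm (n + 2) (n + 2)` and the certificate at `k` survive; both are
    -- referred to `aperyTerm (n + 1) (n + 1)`.
    · have s1 := aperyTerm_succ_right (n + 2) (n + 1)
      have s2 := aperyTerm_succ_left (n + 1) (n + 1)
      push_cast at s1 s2
      have f2 : (aperyTerm (n + 1 + 1) (n + 1 + 1) : ℚ) =
          (2 * n + 4) * (2 * n + 3) / (n + 2) ^ 2 * aperyTerm (n + 1) (n + 1) := by
        have : (n : ℚ) + 2 ≠ 0 := by positivity
        field_simp
        linear_combination s1 + (2 * n + 4) * s2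
      rw [f0, f1, f2]
      push_cast
      have : (n : ℚ) + 2 ≠ 0 := by positivity
      field_simp
      ring
    · have f2 : (aperyTerm (n + 2) (k + 1) : ℚ) = 0 := by
        simp [aperyTerm_eq_zero (show n + 2 < k + 1 by omega)]
      have f3 : (aperyTerm (n + 1) k : ℚ) = 0 := by
        simp [aperyTerm_eq_zero h']
      rw [f0, f1, f2, f3]
      ring

theorem sum_aperyOp (n K : ℕ) : ∑ k ∈ Finset.range (K + 1), aperyOp n k = aperyCert n K := by
  induction K with
  | zero => simp [aperyOp_zero]
  | succ K ih => rw [Finset.sum_range_succ, ih, aperyOp_succ]; ring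

theorem sum_aperyTerm_sq_extend {n N : ℕ} (h : n ≤ N) :
    ∑ k ∈ Finset.range (N + 1), (aperyTerm n k : ℚ) ^ 2 =
      ∑ k ∈ Finset.range (n + 1), (aperyTerm n k : ℚ) ^ 2 := by
  symm
  refine Finset.sum_subset (Finset.range_mono (by omega)) fun k _ hk => ?_
  simp only [Finset.mem_range] at hk
  simp [aperyTerm_eq_zero (show n < k by omega)]

/-- The closed form of the Apéry numbers. -/
theorem aperyB_eq_sum (n : ℕ) :
    aperyB n = ∑ k ∈ Finset.range (n + 1), (aperyTerm n k : ℚ) ^ 2 := by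
  induction n using Nat.twoStepInduction with
  | zero => simp [aperyB, aperyTerm]
  | one => norm_num [aperyB, aperyTerm, Finset.sum_range_succ]
  | more n ih1 ih2 =>
    have key := sum_aperyOp n (n + 2)
    -- The range up to `n + 2` covers the support of all three summands, and the certificate has
    -- already vanished at its end.
    have hz : aperyCert n (n + 2) = 0 := by
      simp [aperyCert, aperyTerm_eq_zero (show n + 1 < n + 2 by omega)]
    simp only [aperyOp, Finset.sum_add_distrib, Finset.sum_sub_distrib, ← Finset.mul_sum] at key
    rw [hz, sum_aperyTerm_sq_extend (show n ≤ n + 2 by omega),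
      sum_aperyTerm_sq_extend (show n + 1 ≤ n + 2 by omega), ← ih1, ← ih2] at key
    simp only [aperyB]
    have : (n : ℚ) + 2 ≠ 0 := by positivity
    field_simp
    linear_combination -key

/-! ### Partial fractions and the moments of the summand -/

open Polynomial in
theorem natDegree_prod_X_add_natCast_le (s : Finset ℕ) :
    (∏ j ∈ s, ((X : ℤ[X]) + (j : ℤ[X]))).natDegree ≤ s.card := by
  refine (natDegree_prod_le _ _).trans ?_
  refine (Finset.sum_le_card_nsmul s _ 1 fun j _ => ?_).trans (by simp)
  exact (natDegree_X_add_C (j : ℤ)).le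

theorem prod_erase_sub_eq {n i : ℕ} (hi : i ∈ Finset.Icc 1 n) :
    ∏ j ∈ (Finset.Icc 1 n).erase i, ((j : ℤ) - i) =
      (-1) ^ (i - 1) * (i - 1).factorial * (n - i).factorial := by
  rw [Finset.mem_Icc] at hi
  have hs : (Finset.Icc 1 n).erase i = Finset.Ico 1 i ∪ Finset.Ico (i + 1) (n + 1) := by
    ext j; simp only [Finset.mem_erase, Finset.mem_Icc, Finset.mem_union, Finset.mem_Ico]; omega
  have hd : Disjoint (Finset.Ico 1 i) (Finset.Ico (i + 1) (n + 1)) := by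
    rw [Finset.disjoint_left]; intro j; simp only [Finset.mem_Ico]; omega
  rw [hs, Finset.prod_union hd, Finset.prod_Ico_eq_prod_range, Finset.prod_Ico_eq_prod_range]
  congr 1
  · rw [← Finset.prod_range_reflect, ← Finset.prod_range_add_one_eq_factorial]
    push_cast
    have : ((-1 : ℤ)) ^ (i - 1) = ∏ _j ∈ Finset.range (i - 1), (-1 : ℤ) := by simp
    rw [this, ← Finset.prod_mul_distrib]
    refine Finset.prod_congr rfl fun j hj => ?_
    rw [Finset.mem_range] at hj
    have : ((i - 1 - 1 - j : ℕ) : ℤ) = (i : ℤ) - 2 - j := by omega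
    rw [this]; ring
  · rw [← Finset.prod_range_add_one_eq_factorial]
    push_cast
    refine Finset.prod_congr rfl fun j _ => ?_
    ring

theorem aperyTerm_mul_factorial {n i : ℕ} (hi : i ≤ n) :
    (aperyTerm n i : ℤ) * (i.factorial * (n - i).factorial) =
      ∏ j ∈ Finset.Icc 1 n, ((j : ℤ) + i) := by
  have h1 : (i.factorial : ℤ) * ∏ j ∈ Finset.Icc 1 n, ((j : ℤ) + i) = (n + i).factorial := by
    have : Finset.Icc 1 n = Finset.Ico 1 (n + 1) := rfl
    rw [this, Finset.prod_Ico_eq_prod_range]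
    have h := Nat.factorial_mul_ascFactorial i n
    rw [Nat.ascFactorial_eq_prod_range] at h
    rw [add_comm n i, ← h]
    push_cast
    congr 1
    refine Finset.prod_congr rfl fun j _ => ?_
    ring
  have h2 : (i.factorial : ℤ) ≠ 0 := by positivity
  refine mul_left_cancel₀ h2 ?_
  rw [h1]
  have e1 := Nat.choose_mul_factorial_mul_factorial hi
  have e2 := Nat.choose_mul_factorial_mul_factorial (Nat.le_add_left i n)
  rw [Nat.add_sub_cancel] at e2
  rw [← e2, ← e1, aperyTerm]
  push_cast
  ring

open Polynomial in
/-- Partial fraction expansion of `∏ (j - t) / (t ∏ (j + t))`, with cleared denominators. -/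
theorem aperyTerm_partialFraction (n : ℕ) :
    ∏ j ∈ Finset.Icc 1 n, ((X : ℤ[X]) + (j : ℤ[X])) +
      X * ∑ k ∈ Finset.Icc 1 n, (C ((-1) ^ k * (aperyTerm n k : ℤ)) : ℤ[X]) *
        ∏ j ∈ (Finset.Icc 1 n).erase k, (X + (j : ℤ[X])) =
      ∏ j ∈ Finset.Icc 1 n, ((j : ℤ[X]) - X) := by
  have inj : Set.InjOn (fun i : ℕ => -(i : ℤ)) (Finset.range (n + 1)) := by
    intro a _ b _ h; simpa using h
  -- Both sides have degree at most `n`, so agreement at the `n + 1` points `0, -1, …, -n` suffices.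
  -- At `-i` with `i > 0` only the summand `k = i` survives.
  refine eq_of_degrees_lt_of_eval_index_eq (Finset.range (n + 1)) inj ?_ ?_ ?_
  · rw [Finset.card_range]
    refine degree_le_natDegree.trans_lt ?_
    norm_cast
    refine Nat.lt_succ_of_le ((natDegree_add_le _ _).trans (max_le ?_ ?_))
    · exact (natDegree_prod_X_add_natCast_le _).trans (by simp)
    · rw [Finset.mul_sum]
      refine natDegree_sum_le_of_forall_le _ _ fun k hk => ?_
      have hc : ((Finset.Icc 1 n).erase k).card = n - 1 := by
        rw [Finset.card_erase_of_mem hk]; simp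
      have hn : 1 ≤ n := by rw [Finset.mem_Icc] at hk; omega
      refine (natDegree_mul_le_of_le natDegree_X_le ((natDegree_C_mul_le _ _).trans
        (natDegree_prod_X_add_natCast_le ((Finset.Icc 1 n).erase k)))).trans ?_
      omega
  · rw [Finset.card_range]
    refine degree_le_natDegree.trans_lt ?_
    norm_cast
    refine Nat.lt_succ_of_le ((natDegree_prod_le _ _).trans ?_)
    refine (Finset.sum_le_card_nsmul _ _ 1 fun j _ => ?_).trans (by simp)
    refine (natDegree_sub_le _ _).trans (max_le ?_ natDegree_X_le)
    simp
  · intro i hi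
    rw [Finset.mem_range] at hi
    simp only [eval_add, eval_mul, eval_prod, eval_X, eval_natCast, eval_sub, eval_finsetSum,
      eval_C]
    rcases Nat.eq_zero_or_pos i with rfl | hpos
    · simp
    have hmem : i ∈ Finset.Icc 1 n := Finset.mem_Icc.2 ⟨hpos, by omega⟩
    rw [Finset.prod_eq_zero hmem (by simp), zero_add, Finset.sum_eq_single i]
    · have h1 := prod_erase_sub_eq hmem
      have h2 := aperyTerm_mul_factorial (show i ≤ n by omega)
      simp only [neg_add_eq_sub, sub_neg_eq_add]
      rw [h1, ← h2]
      obtain ⟨m, rfl⟩ : ∃ m, i = m + 1 := ⟨i - 1, by omega⟩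
      have h3 : ((-1 : ℤ) ^ m) * (-1) ^ m = 1 := by rw [← mul_pow]; simp
      simp only [Nat.add_sub_cancel, Nat.factorial_succ, pow_succ]
      push_cast
      linear_combination (((m : ℤ) + 1) * aperyTerm n (m + 1) * m.factorial *
        (n - (m + 1)).factorial) * h3
    · intro k _ hk
      rw [Finset.prod_eq_zero (Finset.mem_erase.2 ⟨hk.symm, hmem⟩) (by simp), mul_zero]
    · exact fun h => absurd hmem h

open Polynomial in
/-- Truncation of `∏ (1 + y_j X)` after the cubic term, by power sums. -/
theorem six_mul_prod_one_add_eq {R ι : Type*} [CommRing R] (s : Finset ι) (y : ι → R) :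
    ∃ q : R[X], 6 * ∏ j ∈ s, (1 + C (y j) * X) =
      6 + C (6 * ∑ j ∈ s, y j) * X
        + C (3 * ((∑ j ∈ s, y j) ^ 2 - ∑ j ∈ s, y j ^ 2)) * X ^ 2
        + C ((∑ j ∈ s, y j) ^ 3 - 3 * (∑ j ∈ s, y j) * (∑ j ∈ s, y j ^ 2)
            + 2 * ∑ j ∈ s, y j ^ 3) * X ^ 3
        + X ^ 4 * q := by
  classical
  induction s using Finset.induction_on with
  | empty => exact ⟨0, by simp⟩
  | insert a s ha ih =>
    obtain ⟨q, hq⟩ := ih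
    simp only [Finset.prod_insert ha, Finset.sum_insert ha]
    generalize ∑ j ∈ s, y j = H1 at *
    generalize ∑ j ∈ s, y j ^ 2 = H2 at *
    generalize ∑ j ∈ s, y j ^ 3 = H3 at *
    refine ⟨q * (1 + C (y a) * X) + C (y a * (H1 ^ 3 - 3 * H1 * H2 + 2 * H3)), ?_⟩
    rw [mul_left_comm, hq]
    simp only [map_mul, map_add, map_sub, map_pow, map_ofNat]
    ring

open Polynomial in
theorem coeff_eq_zero_of_add_X_pow_five_eq_zero {R : Type*} [CommRing R] {a b c d : R} {q : R[X]}
    (h : C a * X + C b * X ^ 2 + C c * X ^ 3 + C d * X ^ 4 + q * X ^ 5 = 0) :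
    a = 0 ∧ b = 0 ∧ c = 0 ∧ d = 0 := by
  have k : ∀ n, (C a * X + C b * X ^ 2 + C c * X ^ 3 + C d * X ^ 4 + q * X ^ 5).coeff n = 0 :=
    fun n => by rw [h, coeff_zero]
  simp only [coeff_add, coeff_C_mul_X, coeff_mul_X_pow'] at k
  exact ⟨by simpa using k 1, by simpa using k 2, by simpa using k 3, by simpa using k 4⟩

open Polynomial in
/-- Comparing coefficients in the partial fraction expansion. -/
theorem powerSum_relations {R ι : Type*} [CommRing R] [DecidableEq ι] (s : Finset ι)
    (y c : ι → R)
    (h : X * ∑ k ∈ s, C (c k * y k) * ∏ j ∈ s.erase k, (1 + C (y j) * X) =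
      ∏ j ∈ s, (1 + C (-y j) * X) - ∏ j ∈ s, (1 + C (y j) * X)) (h1 h2 h3 e1 e2 e3 e4 : R)
    (hh1 : h1 = ∑ j ∈ s, y j) (hh2 : h2 = ∑ j ∈ s, y j ^ 2) (hh3 : h3 = ∑ j ∈ s, y j ^ 3)
    (he1 : e1 = ∑ j ∈ s, c j * y j) (he2 : e2 = ∑ j ∈ s, c j * y j ^ 2)
    (he3 : e3 = ∑ j ∈ s, c j * y j ^ 3) (he4 : e4 = ∑ j ∈ s, c j * y j ^ 4) :
    6 * e1 = -12 * h1 ∧ 6 * (e1 * h1 - e2) = 0 ∧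
    3 * e1 * (h1 ^ 2 - h2) - 6 * e2 * h1 + 6 * e3 = -2 * (h1 ^ 3 - 3 * h1 * h2 + 2 * h3) ∧
    e1 * (h1 ^ 3 - 3 * h1 * h2 + 2 * h3) - 3 * e2 * (h1 ^ 2 - h2) + 6 * e3 * h1 - 6 * e4 = 0 := by
  obtain ⟨q, hq⟩ := six_mul_prod_one_add_eq s y
  simp only [← hh1, ← hh2, ← hh3] at hq
  -- The two products are `P(X)` and `P(-X)`, so one truncation serves both.
  have hM : (∏ j ∈ s, (1 + C (y j) * X)).comp (-X) = ∏ j ∈ s, (1 + C (-y j) * X) := by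
    rw [prod_comp]
    refine Finset.prod_congr rfl fun j _ => ?_
    simp
  have hr := congrArg (fun f : R[X] => f.comp (-X)) hq
  have h6 : (6 : R[X]).comp (-X) = 6 := ofNat_comp 6
  simp only [mul_comp, add_comp, C_comp, X_comp, pow_comp, h6, hM] at hr
  -- The coefficient of `X ^ 4` in `6 P(X)` and in `6 P(-X)` is the constant coefficient `a` of `q`.
  -- Once split off it cancels, so fourth coefficients can be compared without knowing it.
  have hdiv := divX_mul_X_add q
  generalize q.coeff 0 = a at hdiv
  generalize q.divX = q' at hdiv
  subst hdiv
  simp only [mul_comp, add_comp, C_comp, X_comp] at hr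
  generalize q'.comp (-X) = r at hr
  -- Termwise this is `y / (1 + y X) = y - y² X + y³ X² - y⁴ X³ + y⁵ X⁴ / (1 + y X)`, multiplied by
  -- the full product.
  have hsum : ∑ k ∈ s, C (c k * y k) * ∏ j ∈ s.erase k, (1 + C (y j) * X) =
      (∏ j ∈ s, (1 + C (y j) * X)) * (C e1 - C e2 * X + C e3 * X ^ 2 - C e4 * X ^ 3)
      + X ^ 4 * ∑ k ∈ s, C (c k * y k ^ 5) * ∏ j ∈ s.erase k, (1 + C (y j) * X) := by
    simp only [he1, he2, he3, he4, map_sum, Finset.sum_mul, Finset.mul_sum,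
      ← Finset.sum_sub_distrib, ← Finset.sum_add_distrib]
    refine Finset.sum_congr rfl fun k hk => ?_
    rw [← Finset.mul_prod_erase s _ hk]
    simp only [map_mul, map_pow]
    ring
  generalize ∑ k ∈ s, C (c k * y k ^ 5) * ∏ j ∈ s.erase k, (1 + C (y j) * X) = t at hsum
  rw [hsum] at h
  clear hsum hM hh1 hh2 hh3 he1 he2 he3 he4
  generalize ∏ j ∈ s, (1 + C (y j) * X) = P at *
  generalize ∏ j ∈ s, (1 + C (-y j) * X) = M at *
  have key : C (6 * e1 + 12 * h1) * X + C (6 * (e1 * h1 - e2)) * X ^ 2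
      + C (3 * e1 * (h1 ^ 2 - h2) - 6 * e2 * h1 + 6 * e3
        + 2 * (h1 ^ 3 - 3 * h1 * h2 + 2 * h3)) * X ^ 3
      + C (e1 * (h1 ^ 3 - 3 * h1 * h2 + 2 * h3) - 3 * e2 * (h1 ^ 2 - h2) + 6 * e3 * h1 - 6 * e4
        ) * X ^ 4 + ((q' * X + C a) * (C e1 - C e2 * X + C e3 * X ^ 2 - C e4 * X ^ 3)
        - C (6 * h1 * e4) + C (3 * (h1 ^ 2 - h2)) * (C e3 - C e4 * X)
        + C (h1 ^ 3 - 3 * h1 * h2 + 2 * h3) * (-C e2 + C e3 * X - C e4 * X ^ 2)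
        + 6 * t + q' + r) * X ^ 5 = 0 := by
    simp only [map_mul, map_add, map_sub, map_pow, map_ofNat] at hq hr ⊢
    linear_combination 6 * h
      - (X * (C e1 - C e2 * X + C e3 * X ^ 2 - C e4 * X ^ 3) + 1) * hq + hr
  obtain ⟨k1, k2, k3, k4⟩ := coeff_eq_zero_of_add_X_pow_five_eq_zero key
  exact ⟨by linear_combination k1, k2, by linear_combination k3, k4⟩

/-! ### Truncated expansions and nested sums -/

section Truncation

variable {R : Type*} [CommRing R]

/-- The expansion of `∏_{j ≤ k} (1 - y_j ^ 2)` up to terms of degree six. -/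
theorem exists_prod_one_sub_sq_expansion (x : R) (w : ℕ → R) (k : ℕ) :
    ∃ α γ δ G : R, ∑ j ∈ Finset.Icc 1 k, (x * w j) ^ 2 = x ^ 2 * α ∧
      ∑ j ∈ Finset.Icc 1 k, (x * w j) ^ 4 = x ^ 4 * γ ∧
      2 * (x ^ 4 * δ) = (x ^ 2 * α) ^ 2 - x ^ 4 * γ ∧
      ∏ j ∈ Finset.Icc 1 k, (1 - (x * w j) ^ 2) = 1 - x ^ 2 * α + x ^ 4 * δ + x ^ 6 * G := by
  induction k with
  | zero => exact ⟨0, 0, 0, 0, by simp⟩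
  | succ k ih =>
    obtain ⟨α, γ, δ, G, h1, h2, h3, h4⟩ := ih
    refine ⟨α + w (k + 1) ^ 2, γ + w (k + 1) ^ 4, δ + α * w (k + 1) ^ 2,
      G * (1 - (x * w (k + 1)) ^ 2) - δ * w (k + 1) ^ 2, ?_, ?_, ?_, ?_⟩
    · rw [Finset.sum_Icc_succ_top (by omega), h1]; ring
    · rw [Finset.sum_Icc_succ_top (by omega), h2]; ring
    · linear_combination h3
    · rw [Finset.prod_Icc_succ_top (by omega), h4]; ring

/-- Multiplication by the inverse of `1 + x * w`, a geometric series as `x` is nilpotent. The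
uncontrolled tail `G` enters only in degree seven, and so disappears from `c * (x * w) ^ 2` and from
`c ^ 2`. -/
theorem term_expansion {x w α δ G c : R} (hx : x ^ 8 = 0)
    (hc : (1 + x * w) * c = x * w * (1 - x ^ 2 * α + x ^ 4 * δ + x ^ 6 * G)) :
    c = (x * w - (x * w) ^ 2 + (x * w) ^ 3 - (x * w) ^ 4 + (x * w) ^ 5 - (x * w) ^ 6 + (x * w) ^ 7)
      - x ^ 2 * α * (x * w - (x * w) ^ 2 + (x * w) ^ 3 - (x * w) ^ 4 + (x * w) ^ 5)
      + x ^ 4 * δ * (x * w - (x * w) ^ 2 + (x * w) ^ 3) + x ^ 7 * (w * G) := by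
  linear_combination (1 - x * w + (x * w) ^ 2 - (x * w) ^ 3 + (x * w) ^ 4 - (x * w) ^ 5
    + (x * w) ^ 6 - (x * w) ^ 7) * hc + (w ^ 8 * c - w ^ 8 + α * w ^ 6
    - w ^ 2 * G - w ^ 4 * δ + x * (w ^ 3 * G + w ^ 5 * δ - w ^ 7 * α)
    - x ^ 2 * (w ^ 4 * G + w ^ 6 * δ - w ^ 8 * α) + x ^ 3 * (w ^ 5 * G + w ^ 7 * δ)
    - x ^ 4 * (w ^ 6 * G + w ^ 8 * δ) + x ^ 5 * w ^ 7 * G - x ^ 6 * w ^ 8 * G) * hx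

theorem term_mul_sq_expansion {x w α δ G c : R} (hx : x ^ 8 = 0)
    (hc : (1 + x * w) * c = x * w * (1 - x ^ 2 * α + x ^ 4 * δ + x ^ 6 * G)) :
    c * (x * w) ^ 2 = ((x * w) ^ 3 - (x * w) ^ 4 + (x * w) ^ 5 - (x * w) ^ 6 + (x * w) ^ 7)
      - x ^ 2 * α * ((x * w) ^ 3 - (x * w) ^ 4 + (x * w) ^ 5) + x ^ 4 * δ * (x * w) ^ 3 := by
  have t : ∀ n, 8 ≤ n → x ^ n = 0 := fun n hn => pow_eq_zero_of_le hn hx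
  rw [term_expansion hx hc, ← sub_eq_zero]
  ring_nf
  simp [t]

theorem term_sq_expansion {x w α δ G c : R} (hx : x ^ 8 = 0)
    (hc : (1 + x * w) * c = x * w * (1 - x ^ 2 * α + x ^ 4 * δ + x ^ 6 * G)) :
    c ^ 2 = ((x * w) ^ 2 - 2 * (x * w) ^ 3 + 3 * (x * w) ^ 4 - 4 * (x * w) ^ 5 + 5 * (x * w) ^ 6
        - 6 * (x * w) ^ 7)
      - 2 * (x ^ 2 * α) * ((x * w) ^ 2 - 2 * (x * w) ^ 3 + 3 * (x * w) ^ 4 - 4 * (x * w) ^ 5)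
      + ((x ^ 2 * α) ^ 2 + 2 * (x ^ 4 * δ)) * ((x * w) ^ 2 - 2 * (x * w) ^ 3) := by
  have t : ∀ n, 8 ≤ n → x ^ n = 0 := fun n hn => pow_eq_zero_of_le hn hx
  rw [term_expansion hx hc, ← sub_eq_zero]
  ring_nf
  simp [t]

/-- The same expansion with sums over `j ≤ k`. -/
theorem term_sums_expansion {x c : R} {w : ℕ → R} {k : ℕ} (hx : x ^ 8 = 0)
    (hc : (1 + x * w k) * c = x * w k * ∏ j ∈ Finset.Icc 1 k, (1 - (x * w j) ^ 2))
    {y A B : R} (hy : y = x * w k) (hA : A = ∑ j ∈ Finset.Icc 1 k, (x * w j) ^ 2)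
    (hB : B = ∑ j ∈ Finset.Icc 1 k, (x * w j) ^ 4) :
    2 * (c * y ^ 2) = 2 * (y ^ 3 - y ^ 4 + y ^ 5 - y ^ 6 + y ^ 7) - 2 * A * (y ^ 3 - y ^ 4 + y ^ 5)
        + (A ^ 2 - B) * y ^ 3 ∧
      c * y ^ 3 = (y ^ 4 - y ^ 5 + y ^ 6 - y ^ 7) - A * (y ^ 4 - y ^ 5) ∧
      c * y ^ 4 = (y ^ 5 - y ^ 6 + y ^ 7) - A * y ^ 5 ∧
      c ^ 2 = (y ^ 2 - 2 * y ^ 3 + 3 * y ^ 4 - 4 * y ^ 5 + 5 * y ^ 6 - 6 * y ^ 7)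
        - 2 * A * (y ^ 2 - 2 * y ^ 3 + 3 * y ^ 4 - 4 * y ^ 5)
        + (2 * A ^ 2 - B) * (y ^ 2 - 2 * y ^ 3) := by
  obtain ⟨α, γ, δ, G, h1, h2, h3, h4⟩ := exists_prod_one_sub_sq_expansion x w k
  rw [h1] at hA
  rw [h2] at hB
  rw [h4] at hc
  have t := term_mul_sq_expansion hx hc
  have u := term_sq_expansion hx hc
  rw [← hy] at t u
  subst hA hB
  refine ⟨by linear_combination 2 * t + y ^ 3 * h3, ?_, ?_, ?_⟩
  · rw [pow_succ y 2, ← mul_assoc, t, hy]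
    linear_combination (w k ^ 8 - α * w k ^ 6 + δ * w k ^ 4) * hx
  · rw [show y ^ 4 = y ^ 2 * y ^ 2 by ring, ← mul_assoc, t, hy]
    linear_combination (-w k ^ 8 + x * w k ^ 9 + α * w k ^ 6 - x * α * w k ^ 7
      + x * δ * w k ^ 5) * hx
  · linear_combination u + (y ^ 2 - 2 * y ^ 3) * h3

/-- This and the next two identities are quasi-shuffle relations: a product of sums splits according
to the order of the indices, with the coincident indices as correction terms. -/
theorem two_mul_sum_mul_partialSum (f : ℕ → R) (n : ℕ) :
    2 * ∑ k ∈ Finset.Icc 1 n, f k * ∑ j ∈ Finset.Icc 1 k, f j =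
      (∑ k ∈ Finset.Icc 1 n, f k) ^ 2 + ∑ k ∈ Finset.Icc 1 n, f k ^ 2 := by
  induction n with
  | zero => simp
  | succ n ih =>
    simp only [Finset.sum_Icc_succ_top (Nat.le_add_left 1 n)] at ih ⊢
    linear_combination ih

theorem three_mul_sum_mul_partialSum_sq (f : ℕ → R) (n : ℕ) :
    3 * ∑ k ∈ Finset.Icc 1 n, f k * (∑ j ∈ Finset.Icc 1 k, f j) ^ 2 =
      (∑ k ∈ Finset.Icc 1 n, f k) ^ 3
        + 3 * ∑ k ∈ Finset.Icc 1 n, f k ^ 2 * ∑ j ∈ Finset.Icc 1 k, f j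
        - ∑ k ∈ Finset.Icc 1 n, f k ^ 3 := by
  induction n with
  | zero => simp
  | succ n ih =>
    simp only [Finset.sum_Icc_succ_top (Nat.le_add_left 1 n)] at ih ⊢
    linear_combination ih

theorem sum_mul_partialSum_add (f g : ℕ → R) (n : ℕ) :
    ∑ k ∈ Finset.Icc 1 n, f k * ∑ j ∈ Finset.Icc 1 k, g j
      + ∑ k ∈ Finset.Icc 1 n, g k * ∑ j ∈ Finset.Icc 1 k, f j =
      (∑ k ∈ Finset.Icc 1 n, f k) * (∑ k ∈ Finset.Icc 1 n, g k)
        + ∑ k ∈ Finset.Icc 1 n, f k * g k := by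
  induction n with
  | zero => simp
  | succ n ih =>
    simp only [Finset.sum_Icc_succ_top (Nat.le_add_left 1 n)] at ih ⊢
    linear_combination ih

end Truncation

/-! ### The symmetry `k ↦ p - k` -/

section Reversal

variable {R : Type*} [CommRing R]

theorem sum_Icc_reflect {M : Type*} [AddCommMonoid M] (f : ℕ → M) (p : ℕ) :
    ∑ k ∈ Finset.Icc 1 (p - 1), f (p - k) = ∑ k ∈ Finset.Icc 1 (p - 1), f k := by
  refine Finset.sum_nbij' (fun k => p - k) (fun k => p - k) ?_ ?_ ?_ ?_ ?_ <;>
    intro k hk <;> simp only [Finset.mem_Icc] at * <;> omega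

/-- `p / (p - k) = -(y + y ^ 2 + ⋯)` for `y = p / k`. -/
theorem reversal_expansion {x w z : R} (hx : x ^ 8 = 0) (h : z * (1 - x * w) = -(x * w)) :
    z = -(x * w + (x * w) ^ 2 + (x * w) ^ 3 + (x * w) ^ 4 + (x * w) ^ 5 + (x * w) ^ 6
      + (x * w) ^ 7) := by
  linear_combination (1 + x * w + (x * w) ^ 2 + (x * w) ^ 3 + (x * w) ^ 4 + (x * w) ^ 5
    + (x * w) ^ 6 + (x * w) ^ 7) * h + (z * w ^ 8 - w ^ 8) * hx

theorem reversal_powers {x w z : R} (hx : x ^ 8 = 0) (h : z * (1 - x * w) = -(x * w)) :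
    z ^ 3 = -((x * w) ^ 3 + 3 * (x * w) ^ 4 + 6 * (x * w) ^ 5 + 10 * (x * w) ^ 6
        + 15 * (x * w) ^ 7) ∧
      z ^ 5 = -((x * w) ^ 5 + 5 * (x * w) ^ 6 + 15 * (x * w) ^ 7) ∧
      z ^ 7 = -(x * w) ^ 7 := by
  have t : ∀ n, 8 ≤ n → x ^ n = 0 := fun n hn => pow_eq_zero_of_le hn hx
  have hz := reversal_expansion hx h
  have h3 : z ^ 3 = -((x * w) ^ 3 + 3 * (x * w) ^ 4 + 6 * (x * w) ^ 5 + 10 * (x * w) ^ 6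
        + 15 * (x * w) ^ 7) := by
    rw [hz, ← sub_eq_zero]
    ring_nf
    simp [t]
  have h5 : z ^ 5 = -((x * w) ^ 5 + 5 * (x * w) ^ 6 + 15 * (x * w) ^ 7) := by
    rw [show z ^ 5 = z ^ 3 * z * z by ring, h3, hz, ← sub_eq_zero]
    ring_nf
    simp [t]
  refine ⟨h3, h5, ?_⟩
  rw [show z ^ 7 = z ^ 5 * z * z by ring, h5, hz, ← sub_eq_zero]
  ring_nf
  simp [t]

theorem powerSum_reversal {x : R} {w : ℕ → R} {p : ℕ} (hx : x ^ 8 = 0)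
    (h : ∀ k ∈ Finset.Icc 1 (p - 1), x * w (p - k) * (1 - x * w k) = -(x * w k)) (H : ℕ → R)
    (hH : ∀ s, H s = ∑ k ∈ Finset.Icc 1 (p - 1), (x * w k) ^ s) :
    2 * H 1 = -(H 2 + H 3 + H 4 + H 5 + H 6 + H 7) ∧
      2 * H 3 = -(3 * H 4 + 6 * H 5 + 10 * H 6 + 15 * H 7) ∧
      2 * H 5 = -(5 * H 6 + 15 * H 7) ∧ 2 * H 7 = 0 := by
  have r : ∀ s, H s = ∑ k ∈ Finset.Icc 1 (p - 1), (x * w (p - k)) ^ s := fun s => by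
    rw [hH, sum_Icc_reflect (fun k => (x * w k) ^ s)]
  have h1 : H 1 = -(H 1 + H 2 + H 3 + H 4 + H 5 + H 6 + H 7) := by
    conv_lhs => rw [r 1]
    simp only [hH, ← Finset.sum_add_distrib, ← Finset.sum_neg_distrib]
    refine Finset.sum_congr rfl fun k hk => ?_
    rw [pow_one, pow_one, reversal_expansion hx (h k hk)]
  have h3 : H 3 = -(H 3 + 3 * H 4 + 6 * H 5 + 10 * H 6 + 15 * H 7) := by
    conv_lhs => rw [r 3]
    simp only [hH, ← Finset.sum_add_distrib, ← Finset.sum_neg_distrib, Finset.mul_sum]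
    exact Finset.sum_congr rfl fun k hk => (reversal_powers hx (h k hk)).1
  have h5 : H 5 = -(H 5 + 5 * H 6 + 15 * H 7) := by
    conv_lhs => rw [r 5]
    simp only [hH, ← Finset.sum_add_distrib, ← Finset.sum_neg_distrib, Finset.mul_sum]
    exact Finset.sum_congr rfl fun k hk => (reversal_powers hx (h k hk)).2.1
  have h7 : H 7 = -H 7 := by
    conv_lhs => rw [r 7]
    simp only [hH, ← Finset.sum_neg_distrib]
    exact Finset.sum_congr rfl fun k hk => (reversal_powers hx (h k hk)).2.2
  refine ⟨by linear_combination h1, by linear_combination h3, by linear_combination h5,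
    by linear_combination h7⟩

/-- The partial sums of `y_j ^ 2` are odd under reversal modulo `x ^ 3`. -/
theorem partialSum_reversal {x : R} {w : ℕ → R} {p : ℕ} (hx : x ^ 8 = 0)
    (h : ∀ k ∈ Finset.Icc 1 (p - 1), x * w (p - k) * (1 - x * w k) = -(x * w k))
    (h2 : x ^ 3 ∣ ∑ k ∈ Finset.Icc 1 (p - 1), (x * w k) ^ 2) {k : ℕ} (hk : k + 1 ≤ p) :
    x ^ 3 ∣ ∑ j ∈ Finset.Icc 1 (p - (k + 1)), (x * w j) ^ 2
      + ∑ j ∈ Finset.Icc 1 k, (x * w j) ^ 2 := by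
  induction k with
  | zero => simpa using h2
  | succ k ih =>
    obtain ⟨a, ha⟩ := ih (by omega)
    have hmem : k + 1 ∈ Finset.Icc 1 (p - 1) := Finset.mem_Icc.2 (by omega)
    have hz := reversal_expansion hx (h (k + 1) hmem)
    rw [show p - (k + 1) = p - (k + 1 + 1) + 1 by omega] at ha hz
    rw [Finset.sum_Icc_succ_top (by omega), hz] at ha
    rw [Finset.sum_Icc_succ_top (Nat.le_add_left 1 k)]
    -- With `y = x * w (k + 1)` and `g = 1 + y + ⋯ + y ^ 5`, the reversed value is `-(y + y ^ 2 *
    -- g)`; its square exceeds `y ^ 2` by `y ^ 3 * (2 * g + y * g ^ 2)`.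
    refine ⟨a - w (k + 1) ^ 3 * (2 * (1 + x * w (k + 1) + (x * w (k + 1)) ^ 2
      + (x * w (k + 1)) ^ 3 + (x * w (k + 1)) ^ 4 + (x * w (k + 1)) ^ 5) + x * w (k + 1) * (1 + x * w (k + 1) + (x * w (k + 1)) ^ 2
      + (x * w (k + 1)) ^ 3 + (x * w (k + 1)) ^ 4 + (x * w (k + 1)) ^ 5) ^ 2), ?_⟩
    linear_combination ha

end Reversal

/-! ### Evaluation of the sum of squares by power sums -/

section Core

variable {R : Type*} [CommRing R]

/-- `∑ y³ A² = ∑ y⁵ A - (1/2) ∑ y⁷`, where `A` denotes the partial sums of `y²`. -/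
theorem two_mul_sum_cube_mul_partialSum_sq {x : R} {w : ℕ → R} {p : ℕ} (hx : x ^ 8 = 0)
    (h : ∀ k ∈ Finset.Icc 1 (p - 1), x * w (p - k) * (1 - x * w k) = -(x * w k))
    (h2 : x ^ 3 ∣ ∑ k ∈ Finset.Icc 1 (p - 1), (x * w k) ^ 2) (A : ℕ → R)
    (hA : ∀ k, A k = ∑ j ∈ Finset.Icc 1 k, (x * w j) ^ 2) :
    2 * ∑ k ∈ Finset.Icc 1 (p - 1), (x * w k) ^ 3 * A k ^ 2 =
      2 * ∑ k ∈ Finset.Icc 1 (p - 1), (x * w k) ^ 5 * A k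
        - ∑ k ∈ Finset.Icc 1 (p - 1), (x * w k) ^ 7 := by
  -- Reversal turns `y_k ^ 3` into `-y_k ^ 3` up to degree four and `A_k` into `-A_{k-1}` modulo `x
  -- ^ 3`. As `A` is divisible by `x ^ 2`, both errors contribute only multiples of `x ^ 8`.
  -- Expanding `(A_k - y_k ^ 2) ^ 2` then gives the claim.
  have key : ∑ k ∈ Finset.Icc 1 (p - 1), (x * w k) ^ 3 * A k ^ 2 =
      -∑ k ∈ Finset.Icc 1 (p - 1), (x * w k) ^ 3 * (A k - (x * w k) ^ 2) ^ 2 := by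
    rw [← sum_Icc_reflect (fun k => (x * w k) ^ 3 * A k ^ 2), ← Finset.sum_neg_distrib]
    refine Finset.sum_congr rfl fun k hk => ?_
    rw [(reversal_powers hx (h k hk)).1]
    rw [Finset.mem_Icc] at hk
    obtain ⟨m, rfl⟩ : ∃ m, k = m + 1 := ⟨k - 1, by omega⟩
    obtain ⟨a, ha⟩ := partialSum_reversal hx h h2 (k := m) (by omega)
    have hA' : A (m + 1) - (x * w (m + 1)) ^ 2 = A m := by
      rw [hA, hA, Finset.sum_Icc_succ_top (Nat.le_add_left 1 m)]; ring
    obtain ⟨α, -, -, -, hα, -⟩ := exists_prod_one_sub_sq_expansion x w m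
    rw [hA', eq_sub_of_add_eq ((hA (p - (m + 1))) ▸ ha : A (p - (m + 1)) + _ = _), ← hA]
    rw [← hA] at hα
    rw [hα]
    generalize w (m + 1) = v
    have t : ∀ n, 8 ≤ n → x ^ n = 0 := fun n hn => pow_eq_zero_of_le hn hx
    rw [← sub_eq_zero]
    ring_nf
    simp [t]
  rw [two_mul]
  nth_rewrite 1 [key]
  rw [← sub_eq_zero, Finset.mul_sum]
  simp only [← Finset.sum_neg_distrib, ← Finset.sum_sub_distrib, ← Finset.sum_add_distrib]
  refine Finset.sum_eq_zero fun k _ => ?_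
  ring

/-- The evaluation of `∑ c_k ^ 2` by power sums, for nilpotent `x` of order eight. -/
theorem sum_sq_eq_powerSums {x i : R} (hx : x ^ 8 = 0) (hi : 6 * i = 1) {p : ℕ} {w c : ℕ → R}
    (hrev : ∀ k ∈ Finset.Icc 1 (p - 1), x * w (p - k) * (1 - x * w k) = -(x * w k))
    (hc : ∀ k ∈ Finset.Icc 1 (p - 1),
      (1 + x * w k) * c k = x * w k * ∏ j ∈ Finset.Icc 1 k, (1 - (x * w j) ^ 2))
    (hpf : (Polynomial.X : Polynomial R) * ∑ k ∈ Finset.Icc 1 (p - 1),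
        Polynomial.C (c k * (x * w k)) * ∏ j ∈ (Finset.Icc 1 (p - 1)).erase k,
          (1 + Polynomial.C (x * w j) * Polynomial.X) =
      ∏ j ∈ Finset.Icc 1 (p - 1), (1 + Polynomial.C (-(x * w j)) * Polynomial.X)
        - ∏ j ∈ Finset.Icc 1 (p - 1), (1 + Polynomial.C (x * w j) * Polynomial.X))
    (H : ℕ → R) (hH : ∀ s, H s = ∑ k ∈ Finset.Icc 1 (p - 1), (x * w k) ^ s)
    (h2 : x ^ 3 ∣ H 2) (h4 : x ^ 5 ∣ H 4) :
    ∑ k ∈ Finset.Icc 1 (p - 1), c k ^ 2 = H 2 - 5 * H 4 - H 6 + H 2 ^ 2 := by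
  obtain ⟨k1, k2, k3, k4⟩ := powerSum_relations (Finset.Icc 1 (p - 1)) (fun k => x * w k) c hpf
    _ _ _ _ _ _ _ rfl rfl rfl rfl rfl rfl rfl
  obtain ⟨r1, r3, r5, r7⟩ := powerSum_reversal hx hrev H hH
  set A : ℕ → R := fun k => ∑ j ∈ Finset.Icc 1 k, (x * w j) ^ 2 with hA
  set B : ℕ → R := fun k => ∑ j ∈ Finset.Icc 1 k, (x * w j) ^ 4 with hB
  have rQ := two_mul_sum_cube_mul_partialSum_sq hx hrev (by rw [← hH]; exact h2) A (fun _ => rfl)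
  have exp := fun k hk => term_sums_expansion (k := k) hx (hc k hk) rfl
    (show A k = _ from rfl) (show B k = _ from rfl)
  have t22 := two_mul_sum_mul_partialSum (fun k => (x * w k) ^ 2) (p - 1)
  have t222 := three_mul_sum_mul_partialSum_sq (fun k => (x * w k) ^ 2) (p - 1)
  have t24 := sum_mul_partialSum_add (fun k => (x * w k) ^ 2) (fun k => (x * w k) ^ 4) (p - 1)
  have c2 := Finset.sum_congr rfl fun k hk => (exp k hk).1
  have c3 := Finset.sum_congr rfl fun k hk => (exp k hk).2.1
  have c4 := Finset.sum_congr rfl fun k hk => (exp k hk).2.2.1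
  have c0 := Finset.sum_congr rfl fun k hk => (exp k hk).2.2.2
  have pw : ∀ y : R, (y ^ 2) ^ 2 = y ^ 4 ∧ (y ^ 2) ^ 3 = y ^ 6 ∧ y ^ 2 * y ^ 4 = y ^ 6 :=
    fun y => ⟨by ring, by ring, by ring⟩
  simp only [(pw _).1, (pw _).2.1, (pw _).2.2, ← hH] at t22 t222 t24
  have hH1 : ∑ k ∈ Finset.Icc 1 (p - 1), x * w k = H 1 := by simp [hH]
  simp only [← hH, hH1] at k1 k2 k3 k4 rQ
  change 2 * ∑ k ∈ Finset.Icc 1 (p - 1), (x * w k) ^ 2 * A k = _ at t22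
  change 3 * ∑ k ∈ Finset.Icc 1 (p - 1), (x * w k) ^ 2 * A k ^ 2 =
    _ + 3 * ∑ k ∈ Finset.Icc 1 (p - 1), (x * w k) ^ 4 * A k - _ at t222
  change ∑ k ∈ Finset.Icc 1 (p - 1), (x * w k) ^ 2 * B k +
    ∑ k ∈ Finset.Icc 1 (p - 1), (x * w k) ^ 4 * A k = _ at t24
  set S22 := ∑ k ∈ Finset.Icc 1 (p - 1), (x * w k) ^ 2 * A k with hS22
  set S23 := ∑ k ∈ Finset.Icc 1 (p - 1), (x * w k) ^ 3 * A k with hS23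
  set S24 := ∑ k ∈ Finset.Icc 1 (p - 1), (x * w k) ^ 4 * A k with hS24
  set S25 := ∑ k ∈ Finset.Icc 1 (p - 1), (x * w k) ^ 5 * A k with hS25
  set S42 := ∑ k ∈ Finset.Icc 1 (p - 1), (x * w k) ^ 2 * B k with hS42
  set S43 := ∑ k ∈ Finset.Icc 1 (p - 1), (x * w k) ^ 3 * B k with hS43
  set SS := ∑ k ∈ Finset.Icc 1 (p - 1), (x * w k) ^ 2 * A k ^ 2 with hSS
  set Q := ∑ k ∈ Finset.Icc 1 (p - 1), (x * w k) ^ 3 * A k ^ 2 with hQ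
  set E1 := ∑ k ∈ Finset.Icc 1 (p - 1), c k * (x * w k) with hE1
  set E2 := ∑ k ∈ Finset.Icc 1 (p - 1), c k * (x * w k) ^ 2 with hE2
  set E3 := ∑ k ∈ Finset.Icc 1 (p - 1), c k * (x * w k) ^ 3 with hE3
  set E4 := ∑ k ∈ Finset.Icc 1 (p - 1), c k * (x * w k) ^ 4 with hE4
  -- The moments `E2`, `E3`, `E4` are known from the partial fractions, so `d4`, `d3` and `d2`
  -- determine `S25`, `S24` and the combination `2 * S23 + S43`. The latter is exactly how `S23` and
  -- `S43` enter `d0`.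
  have d2 : 2 * E2 = 2 * (H 3 - H 4 + H 5 - H 6 + H 7) - 2 * (S23 - S24 + S25) + Q - S43 := by
    rw [hE2, Finset.mul_sum, c2]
    simp only [hH, hS23, hS24, hS25, hQ, hS43, Finset.mul_sum, ← Finset.sum_sub_distrib,
      ← Finset.sum_add_distrib]
    exact Finset.sum_congr rfl fun k _ => by ring
  have d3 : E3 = H 4 - H 5 + H 6 - H 7 - S24 + S25 := by
    rw [c3]
    simp only [hH, hS24, hS25, ← Finset.sum_sub_distrib, ← Finset.sum_add_distrib]
    exact Finset.sum_congr rfl fun k _ => by ring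
  have d4 : E4 = H 5 - H 6 + H 7 - S25 := by
    rw [c4]
    simp only [hH, hS25, ← Finset.sum_sub_distrib, ← Finset.sum_add_distrib]
    exact Finset.sum_congr rfl fun k _ => by ring
  have d0 : ∑ k ∈ Finset.Icc 1 (p - 1), c k ^ 2 =
      (H 2 - 2 * H 3 + 3 * H 4 - 4 * H 5 + 5 * H 6 - 6 * H 7)
      - 2 * (S22 - 2 * S23 + 3 * S24 - 4 * S25) + 2 * (SS - 2 * Q) - (S42 - 2 * S43) := by
    rw [c0]
    simp only [hH, hS22, hS23, hS24, hS25, hS42, hS43, hSS, hQ, Finset.mul_sum,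
      ← Finset.sum_sub_distrib, ← Finset.sum_add_distrib]
    exact Finset.sum_congr rfl fun k _ => by ring
  rw [d0]
  have hdvd : ∀ s, x ^ s ∣ H s := fun s => by
    rw [hH]; exact Finset.dvd_sum fun k _ => ⟨w k ^ s, by ring⟩
  obtain ⟨b2, e2⟩ := h2
  obtain ⟨b4, e4⟩ := h4
  obtain ⟨b5, e5⟩ := hdvd 5
  obtain ⟨b6, e6⟩ := hdvd 6
  have e7 : H 7 = 0 := by linear_combination 3 * i * r7 - H 7 * hi
  rw [e7] at r1 r3 r5 rQ d2 d3 d4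
  rw [e7]
  clear_value S22 S23 S24 S25 S42 S43 SS Q E1 E2 E3 E4
  clear hS22 hS23 hS24 hS25 hS42 hS43 hSS hQ hE1 hE2 hE3 hE4 c2 c3 c4 c0 d0 exp hpf hdvd
  generalize H 1 = H1 at *
  generalize H 2 = H2 at *
  generalize H 3 = H3 at *
  generalize H 4 = H4 at *
  generalize H 5 = H5 at *
  generalize H 6 = H6 at *
  have cancel : ∀ a : R, 6 * a = 0 → a = 0 := fun a ha => by
    linear_combination i * ha - a * hi
  have f5 : 2 * H5 = -5 * H6 := by linear_combination r5
  have f3 : 2 * H3 = -3 * H4 + 5 * H6 := by linear_combination r3 - 3 * f5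
  obtain ⟨b3, e3⟩ : ∃ b, H3 = x ^ 5 * b :=
    ⟨3 * i * (-3 * b4 + 5 * x * b6), by
      linear_combination 3 * i * f3 - H3 * hi - 9 * i * e4 + 15 * i * e6⟩
  obtain ⟨b1, e1⟩ : ∃ b, H1 = x ^ 3 * b :=
    ⟨3 * i * -(b2 + x ^ 2 * b3 + x ^ 2 * b4 + x ^ 2 * b5 + x ^ 3 * b6), by
      linear_combination 3 * i * r1 - H1 * hi - 3 * i * (e2 + e3 + e4 + e5 + e6)⟩
  -- Reversal gives `2 * H1 ≡ -H2` modulo `x ^ 5`; since `x ^ 3` divides `H2`, the squares agree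
  -- exactly.
  have q1 : 4 * H1 ^ 2 = H2 ^ 2 := by
    have : 2 * H1 = -(H2 + x ^ 5 * (b3 + b4 + b5 + x * b6)) := by
      linear_combination r1 - e3 - e4 - e5 - e6
    have h' : 4 * H1 ^ 2 = (2 * H1) ^ 2 := by ring
    rw [h', this, e2]
    linear_combination (2 * b2 * (b3 + b4 + b5 + x * b6)
      + x ^ 2 * (b3 + b4 + b5 + x * b6) ^ 2) * hx
  have g1 : E1 = -2 * H1 := by linear_combination i * k1 - (E1 + 2 * H1) * hi
  have g2 : 2 * E2 = -H2 ^ 2 := by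
    have := cancel _ k2
    rw [g1] at this
    linear_combination -2 * this - q1
  have z13 : H1 * H1 ^ 2 = 0 := by rw [e1]; linear_combination x * b1 ^ 3 * hx
  have z122 : H1 * H2 ^ 2 = 0 := by rw [e1, e2]; linear_combination x * b1 * b2 ^ 2 * hx
  have g3 : 3 * E3 = -2 * H3 := by
    have : 6 * (3 * E3 + 2 * H3) = 0 := by
      rw [g1] at k3
      linear_combination 3 * k3 + 12 * z13 + 9 * H1 * g2 - 9 * z122
    linear_combination cancel _ this
  have t : ∀ n, 8 ≤ n → x ^ n = 0 := fun n hn => pow_eq_zero_of_le hn hx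
  have g4 : E4 = 0 := by
    have hz : -12 * H1 ^ 4 + 36 * H1 ^ 2 * H2 - 48 * H1 * H3 + 9 * H2 ^ 2 * (H1 ^ 2 - H2) = 0 := by
      rw [e1, e2, e3]
      ring_nf
      simp [t]
    have : 6 * (6 * E4) = 0 := by
      rw [g1] at k4
      linear_combination -6 * k4 + hz - 9 * (H1 ^ 2 - H2) * g2 + 12 * H1 * g3
    exact cancel _ (cancel _ this)
  rw [g4] at d4
  have s25 : 2 * S25 = -7 * H6 := by linear_combination 2 * d4 + f5
  have s24 : 6 * S24 = 10 * H6 := by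
    linear_combination 6 * d3 - 2 * g3 + 2 * f3 + 6 * d4
  have z24 : H2 * H4 = 0 := by rw [e2, e4]; linear_combination b2 * b4 * hx
  have z222 : H2 ^ 3 = 0 := by rw [e2]; linear_combination x * b2 ^ 3 * hx
  refine sub_eq_zero.1 (cancel _ ?_)
  -- The quasi-shuffle relations remove `S22`, `SS` and `S42`, `rQ` removes `Q`, and the moment
  -- relations remove the rest.
  linear_combination -6 * t22 + 12 * d2 - 12 * g2 + 4 * t222 - 6 * t24 - 6 * rQ + 6 * s25 + s24
    + 6 * f3 + 4 * z222 - 6 * z24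

end Core

/-! ### The Apéry summand at `n = p - 1` -/

section Specialization

variable {R : Type*} [CommRing R]

theorem reversal_of_inverse {p : ℕ} {w : ℕ → R} (hw : ∀ k ∈ Finset.Icc 1 (p - 1), (k : R) * w k = 1)
    {k : ℕ} (hk : k ∈ Finset.Icc 1 (p - 1)) :
    (p : R) * w (p - k) * (1 - p * w k) = -(p * w k) := by
  have h1 := hw k hk
  rw [Finset.mem_Icc] at hk
  have h2 := hw (p - k) (Finset.mem_Icc.2 (by omega))
  rw [Nat.cast_sub (by omega)] at h2
  linear_combination (-(p : R) * w k) * h2 - p * w (p - k) * h1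

/-- By contiguity, passing from `k` to `k + 1` multiplies the left side by `-(p - (k + 1)) (p + (k +
1)) / (k + 1) ^ 2 = 1 - (p / (k + 1)) ^ 2`. -/
theorem add_mul_aperyTerm {p : ℕ} {w : ℕ → R} (hp : 1 ≤ p)
    (hw : ∀ k ∈ Finset.Icc 1 (p - 1), (k : R) * w k = 1) {k : ℕ} (hk : k ≤ p - 1) :
    ((p : R) + k) * ((-1) ^ k * (aperyTerm (p - 1) k : R)) =
      p * ∏ j ∈ Finset.Icc 1 k, (1 - (p * w j) ^ 2) := by
  induction k with
  | zero => simp [aperyTerm_zero_right]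
  | succ k ih =>
    have h1 := hw (k + 1) (Finset.mem_Icc.2 (by omega))
    have hZ : ((k : ℤ) + 1) ^ 2 * aperyTerm (p - 1) (k + 1) =
        ((p : ℤ) - 1 - k) * (p + k) * aperyTerm (p - 1) k := by
      have := aperyTerm_succ_right (p - 1) k
      rw [Nat.cast_sub hp] at this
      have h' : ((k : ℚ) + 1) ^ 2 * aperyTerm (p - 1) (k + 1) =
        ((p : ℚ) - 1 - k) * (p + k) * aperyTerm (p - 1) k := by
        push_cast at this
        linear_combination this
      exact_mod_cast h'
    have hR := congrArg (Int.cast : ℤ → R) hZ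
    push_cast at hR h1 ⊢
    have ih' := ih (by omega)
    rw [Finset.prod_Icc_succ_top (by omega)]
    generalize (aperyTerm (p - 1) (k + 1) : R) = a at *
    generalize (aperyTerm (p - 1) k : R) = b at *
    generalize w (k + 1) = v at *
    rw [pow_succ]
    linear_combination (-(p + k + 1) * (-1) ^ k * v ^ 2) * hR
      + ((-1) ^ k * (p + k + 1) * a * ((k + 1) * v + 1)
        + (p + k) * (-1) ^ k * b * ((k + 1) * v + 1)) * h1 + (1 - (p * v) ^ 2) * ih'

theorem one_add_mul_aperyTerm {p : ℕ} {w : ℕ → R} (hp : 1 ≤ p)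
    (hw : ∀ k ∈ Finset.Icc 1 (p - 1), (k : R) * w k = 1) {k : ℕ} (hk : k ∈ Finset.Icc 1 (p - 1)) :
    (1 + p * w k) * ((-1) ^ k * (aperyTerm (p - 1) k : R)) =
      p * w k * ∏ j ∈ Finset.Icc 1 k, (1 - (p * w j) ^ 2) := by
  have h := add_mul_aperyTerm hp hw (Finset.mem_Icc.1 hk).2
  linear_combination w k * h - ((-1) ^ k * (aperyTerm (p - 1) k : R)) * hw k hk

open Polynomial in
-- Substitution of `x X` for `X`, followed by division by `n!`, which is invertible because each
-- factor is.
theorem aperyTerm_partialFraction_scaled {n : ℕ} {x : R} {w : ℕ → R}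
    (hw : ∀ k ∈ Finset.Icc 1 n, (k : R) * w k = 1) :
    X * ∑ k ∈ Finset.Icc 1 n, C ((-1) ^ k * (aperyTerm n k : R) * (x * w k)) *
        ∏ j ∈ (Finset.Icc 1 n).erase k, (1 + C (x * w j) * X) =
      ∏ j ∈ Finset.Icc 1 n, (1 + C (-(x * w j)) * X)
        - ∏ j ∈ Finset.Icc 1 n, (1 + C (x * w j) * X) := by
  have h := congrArg (aeval (C x * X : R[X])) (aperyTerm_partialFraction n)
  simp only [map_add, map_mul, map_prod, map_sum, map_sub, map_natCast, aeval_X, map_pow,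
    map_neg, map_one] at h
  have hC : ∀ j ∈ Finset.Icc 1 n, (j : R[X]) * C (w j) = 1 := fun j hj => by
    rw [← C_eq_natCast, ← C_mul, hw j hj, C_1]
  have hp : ∀ j ∈ Finset.Icc 1 n, C x * X + (j : R[X]) = (j : R[X]) * (1 + C (x * w j) * X) := by
    intro j hj
    rw [C_mul]
    linear_combination (-C x * X) * hC j hj
  have hm : ∀ j ∈ Finset.Icc 1 n, (j : R[X]) - C x * X = (j : R[X]) * (1 + C (-(x * w j)) * X) := by
    intro j hj
    rw [C_neg, C_mul]
    linear_combination (C x * X) * hC j hj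
  rw [Finset.prod_congr rfl hp, Finset.prod_congr rfl hm, Finset.prod_mul_distrib,
    Finset.prod_mul_distrib] at h
  have hs : ∀ k ∈ Finset.Icc 1 n, (-1) ^ k * (aperyTerm n k : R[X]) *
      ∏ j ∈ (Finset.Icc 1 n).erase k, (C x * X + (j : R[X])) =
      (∏ j ∈ Finset.Icc 1 n, (j : R[X])) * (C ((-1) ^ k * (aperyTerm n k : R) * w k) *
        ∏ j ∈ (Finset.Icc 1 n).erase k, (1 + C (x * w j) * X)) := by
    intro k hk
    rw [Finset.prod_congr rfl (fun j hj => hp j (Finset.mem_of_mem_erase hj)),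
      Finset.prod_mul_distrib, ← Finset.mul_prod_erase (Finset.Icc 1 n) (fun j => (j : R[X])) hk]
    simp only [map_mul, map_pow, map_neg, map_one, map_natCast]
    linear_combination (-(-1) ^ k * (aperyTerm n k : R[X]) *
      (∏ j ∈ (Finset.Icc 1 n).erase k, (j : R[X])) *
      ∏ j ∈ (Finset.Icc 1 n).erase k, (1 + C x * C (w j) * X)) * hC k hk
  rw [Finset.sum_congr rfl hs, ← Finset.mul_sum] at h
  have hu : (∏ j ∈ Finset.Icc 1 n, (j : R[X])) * ∏ j ∈ Finset.Icc 1 n, C (w j) = 1 := by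
    rw [← Finset.prod_mul_distrib]
    exact Finset.prod_eq_one hC
  have hx : ∑ k ∈ Finset.Icc 1 n, C ((-1) ^ k * (aperyTerm n k : R) * (x * w k)) *
        ∏ j ∈ (Finset.Icc 1 n).erase k, (1 + C (x * w j) * X) =
      C x * ∑ k ∈ Finset.Icc 1 n, C ((-1) ^ k * (aperyTerm n k : R) * w k) *
        ∏ j ∈ (Finset.Icc 1 n).erase k, (1 + C (x * w j) * X) := by
    rw [Finset.mul_sum]
    refine Finset.sum_congr rfl fun k _ => ?_
    simp only [map_mul]
    ring
  rw [hx]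
  generalize ∏ j ∈ Finset.Icc 1 n, (j : R[X]) = U at *
  generalize ∏ j ∈ Finset.Icc 1 n, C (w j) = V at *
  generalize ∑ k ∈ Finset.Icc 1 n, C ((-1) ^ k * (aperyTerm n k : R) * w k) *
        ∏ j ∈ (Finset.Icc 1 n).erase k, (1 + C (x * w j) * X) = S at *
  generalize ∏ j ∈ Finset.Icc 1 n, (1 + C (-(x * w j)) * X) = M at *
  generalize ∏ j ∈ Finset.Icc 1 n, (1 + C (x * w j) * X) = P at *
  linear_combination V * h + (M - P - X * C x * S) * hu

end Specialization

/-! ### Reduction of the Apéry number modulo `p ^ 8` -/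

section PadicSpecialization

variable (p : ℕ) [Fact p.Prime]

theorem exists_padicInt_inverse :
    ∃ w : ℕ → ℤ_[p], ∀ k ∈ Finset.Icc 1 (p - 1), (k : ℤ_[p]) * w k = 1 := by
  have h : ∀ k : ℕ, ∃ v : ℤ_[p], k ∈ Finset.Icc 1 (p - 1) → (k : ℤ_[p]) * v = 1 := by
    intro k
    by_cases hk : k ∈ Finset.Icc 1 (p - 1)
    · have hu : IsUnit (k : ℤ_[p]) := by
        rw [PadicInt.isUnit_iff, PadicInt.norm_natCast_eq_one_iff]
        rw [Finset.mem_Icc] at hk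
        exact (Nat.coprime_of_lt_prime (by omega) (by omega) (Fact.out : p.Prime))
      obtain ⟨v, hv⟩ := hu.exists_right_inv
      exact ⟨v, fun _ => hv⟩
    · exact ⟨0, fun h => absurd h hk⟩
  choose w hw using h
  exact ⟨w, hw⟩

variable {p}

theorem sum_Icc_eq_sum_zmod {M : Type*} [AddCommMonoid M] (f : ZMod p → M) (h0 : f 0 = 0) :
    ∑ k ∈ Finset.Icc 1 (p - 1), f (k : ZMod p) = ∑ a : ZMod p, f a := by
  have hp : 0 < p := (Fact.out : p.Prime).pos
  have : ∑ k ∈ Finset.range p, f (k : ZMod p) = ∑ a : ZMod p, f a := by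
    refine Finset.sum_bij' (fun k _ => (k : ZMod p)) (fun a _ => a.val) ?_ ?_ ?_ ?_ ?_
    · simp
    · intro a _; simpa using ZMod.val_lt a
    · intro k hk; exact ZMod.val_cast_of_lt (by simpa using hk)
    · intro a _; exact ZMod.natCast_zmod_val a
    · intro k _; rfl
  have hr : Finset.range p = insert 0 (Finset.Icc 1 (p - 1)) := by
    ext k; simp only [Finset.mem_range, Finset.mem_insert, Finset.mem_Icc]; omega
  rw [← this, hr, Finset.sum_insert (by simp), Nat.cast_zero, h0, zero_add]

/-- Modulo `p`, inversion permutes the residues, and power sums over `ZMod p` with exponent below `p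
- 1` vanish. -/
theorem dvd_sum_inverse_pow {w : ℕ → ℤ_[p]} (hw : ∀ k ∈ Finset.Icc 1 (p - 1), (k : ℤ_[p]) * w k = 1)
    {s : ℕ} (hs : s ≠ 0) (hsp : s < p - 1) : (p : ℤ_[p]) ∣ ∑ k ∈ Finset.Icc 1 (p - 1), w k ^ s := by
  rw [← Ideal.mem_span_singleton, ← PadicInt.maximalIdeal_eq_span_p, ← PadicInt.ker_toZMod,
    RingHom.mem_ker, map_sum]
  have h1 : ∀ k ∈ Finset.Icc 1 (p - 1), PadicInt.toZMod (w k ^ s) = ((k : ZMod p)⁻¹) ^ s := by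
    intro k hk
    have := congrArg (PadicInt.toZMod (p := p)) (hw k hk)
    rw [map_mul, map_natCast, map_one] at this
    rw [map_pow, eq_inv_of_mul_eq_one_right this]
  rw [Finset.sum_congr rfl h1, sum_Icc_eq_sum_zmod (fun a : ZMod p => a⁻¹ ^ s) (by simp [hs])]
  rw [← FiniteField.sum_pow_lt_card_sub_one (ZMod p) s (by rwa [ZMod.card])]
  exact (inv_involutive (G := ZMod p)).bijective.sum_comp (fun a : ZMod p => a ^ s)

/-- The Apéry number `b_{p-1}` modulo `p ^ 8`, in terms of harmonic sums. -/
theorem sum_aperyTerm_sq_congr (hp : 7 ≤ p) {w : ℕ → ℤ_[p]}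
    (hw : ∀ k ∈ Finset.Icc 1 (p - 1), (k : ℤ_[p]) * w k = 1) (H : ℕ → ℤ_[p])
    (hH : ∀ s, H s = ∑ k ∈ Finset.Icc 1 (p - 1), (p * w k) ^ s) :
    (p : ℤ_[p]) ^ 8 ∣ ∑ k ∈ Finset.range p, (aperyTerm (p - 1) k : ℤ_[p]) ^ 2
      - (1 + H 2 - 5 * H 4 - H 6 + H 2 ^ 2) := by
  rw [← Ideal.mem_span_singleton, ← PadicInt.ker_toZModPow, RingHom.mem_ker]
  set φ := PadicInt.toZModPow (p := p) 8
  have hwφ : ∀ k ∈ Finset.Icc 1 (p - 1), (k : ZMod (p ^ 8)) * φ (w k) = 1 := fun k hk => by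
    rw [← map_natCast φ, ← map_mul, hw k hk, map_one]
  have hx : (p : ZMod (p ^ 8)) ^ 8 = 0 := by
    rw [← Nat.cast_pow, ZMod.natCast_self]
  have h6 : (6 : ZMod (p ^ 8)) * φ (w 6) = 1 := by
    have := hwφ 6 (Finset.mem_Icc.2 (by omega))
    exact_mod_cast this
  have hHφ : ∀ s, φ (H s) = ∑ k ∈ Finset.Icc 1 (p - 1), (p * φ (w k)) ^ s := fun s => by
    rw [hH, map_sum]; simp
  have hdvd : ∀ s, s ≠ 0 → s < p - 1 → (p : ZMod (p ^ 8)) ^ (s + 1) ∣ φ (H s) := by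
    intro s hs hs'
    have h : (p : ℤ_[p]) ^ (s + 1) ∣ H s := by
      rw [hH, pow_succ]
      simp only [mul_pow, ← Finset.mul_sum]
      exact mul_dvd_mul_left _ (dvd_sum_inverse_pow hw hs hs')
    simpa using map_dvd φ h
  have key := sum_sq_eq_powerSums (c := fun k => (-1) ^ k * (aperyTerm (p - 1) k : ZMod (p ^ 8)))
    hx h6 (fun k hk => reversal_of_inverse hwφ hk)
    (fun k hk => one_add_mul_aperyTerm (by omega) hwφ hk)
    (aperyTerm_partialFraction_scaled hwφ) (fun s => φ (H s)) hHφ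
    (hdvd 2 (by norm_num) (by omega)) (hdvd 4 (by norm_num) (by omega))
  have hsum : φ (∑ k ∈ Finset.range p, (aperyTerm (p - 1) k : ℤ_[p]) ^ 2) =
      1 + ∑ k ∈ Finset.Icc 1 (p - 1), ((-1) ^ k * (aperyTerm (p - 1) k : ZMod (p ^ 8))) ^ 2 := by
    rw [map_sum]
    have hr : Finset.range p = insert 0 (Finset.Icc 1 (p - 1)) := by
      ext k; simp only [Finset.mem_range, Finset.mem_insert, Finset.mem_Icc]; omega
    rw [hr, Finset.sum_insert (by simp)]
    congr 1
    · simp [aperyTerm_zero_right]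
    · refine Finset.sum_congr rfl fun k _ => ?_
      rw [mul_pow, ← pow_mul, mul_comm k 2, pow_mul]
      simp
  rw [map_sub, hsum, key]
  simp only [map_add, map_sub, map_mul, map_pow, map_one, map_ofNat]
  ring

end PadicSpecialization

/-! ### Bernoulli numbers as limits of power sums, and carries -/

section PowerSums

variable (p : ℕ) [Fact p.Prime]

theorem tendsto_natCast_pow_atTop : Tendsto (fun r : ℕ => (p : ℚ_[p]) ^ r) atTop (𝓝 0) :=
  tendsto_pow_atTop_nhds_zero_of_norm_lt_one Padic.norm_p_lt_one

theorem padic_natCast_ne_zero : (p : ℚ_[p]) ≠ 0 :=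
  Nat.cast_ne_zero.2 (Fact.out : p.Prime).ne_zero

/-- Bernoulli numbers are limits of normalized power sums. -/
theorem tendsto_sum_pow_div (m : ℕ) :
    Tendsto (fun r : ℕ => (∑ j ∈ Finset.range (p ^ r), (j : ℚ_[p]) ^ m) / (p : ℚ_[p]) ^ r) atTop
      (𝓝 ((bernoulli m : ℚ) : ℚ_[p])) := by
  have h : ∀ r : ℕ, (∑ j ∈ Finset.range (p ^ r), (j : ℚ_[p]) ^ m) / (p : ℚ_[p]) ^ r =
      ∑ i ∈ Finset.range (m + 1), ((bernoulli i : ℚ) : ℚ_[p]) * ((m + 1).choose i) / (m + 1) *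
        ((p : ℚ_[p]) ^ r) ^ (m - i) := by
    intro r
    have h1 := congrArg (fun q : ℚ => (q : ℚ_[p])) (sum_range_pow (p ^ r) m)
    push_cast at h1
    rw [h1, Finset.sum_div]
    refine Finset.sum_congr rfl fun i hi => ?_
    rw [Finset.mem_range] at hi
    rw [show m + 1 - i = (m - i) + 1 by omega, pow_succ]
    have := pow_ne_zero r (padic_natCast_ne_zero p)
    have h2 : ((m : ℚ_[p]) + 1) ≠ 0 := by exact_mod_cast Nat.succ_ne_zero m
    field_simp
  simp only [h]
  rw [show ((bernoulli m : ℚ) : ℚ_[p]) = ∑ i ∈ Finset.range (m + 1),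
      ((bernoulli i : ℚ) : ℚ_[p]) * ((m + 1).choose i) / (m + 1) * (0 : ℚ_[p]) ^ (m - i) from ?_]
  · exact tendsto_finsetSum _ fun i _ =>
      ((tendsto_natCast_pow_atTop p).pow (m - i)).const_mul _
  · rw [Finset.sum_range_succ, Finset.sum_eq_zero]
    · have h2 : ((m : ℚ_[p]) + 1) ≠ 0 := by exact_mod_cast Nat.succ_ne_zero m
      simp [h2]
    · intro i hi
      rw [Finset.mem_range] at hi
      rw [zero_pow (by omega), mul_zero]

/-- Power sums over the residues prime to `p`. -/
theorem tendsto_sum_coprime_pow_div {m : ℕ} (hm : 1 ≤ m) :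
    Tendsto (fun r : ℕ => (∑ j ∈ Finset.range (p ^ r) with ¬ p ∣ j, (j : ℚ_[p]) ^ m) /
      (p : ℚ_[p]) ^ r) atTop (𝓝 ((1 - (p : ℚ_[p]) ^ (m - 1)) * ((bernoulli m : ℚ) : ℚ_[p]))) := by
  -- The multiples of `p` below `p ^ (r + 1)` contribute `p ^ m` times the full sum up to `p ^ r`,
  -- hence the shift by one and the factor `p ^ (m - 1)`.
  rw [← tendsto_add_atTop_iff_nat 1]
  have h1 := (tendsto_add_atTop_iff_nat 1).2 (tendsto_sum_pow_div p m)
  have h2 := (tendsto_sum_pow_div p m).const_mul ((p : ℚ_[p]) ^ (m - 1))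
  have h3 := h1.sub h2
  rw [sub_mul, one_mul]
  refine h3.congr fun r => ?_
  have hp : 0 < p := (Fact.out : p.Prime).pos
  have hdiv : ∑ j ∈ Finset.range (p ^ (r + 1)) with p ∣ j, (j : ℚ_[p]) ^ m =
      (p : ℚ_[p]) ^ m * ∑ j ∈ Finset.range (p ^ r), (j : ℚ_[p]) ^ m := by
    rw [Finset.mul_sum]
    symm
    refine Finset.sum_bij' (fun j _ => p * j) (fun j _ => j / p) ?_ ?_ ?_ ?_ ?_
    · intro j hj
      simp only [Finset.mem_filter, Finset.mem_range] at hj ⊢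
      exact ⟨by rw [pow_succ, mul_comm]; exact Nat.mul_lt_mul_of_pos_right hj hp, dvd_mul_right _ _⟩
    · intro j hj
      simp only [Finset.mem_filter, Finset.mem_range] at hj ⊢
      rw [Nat.div_lt_iff_lt_mul hp, ← pow_succ]
      exact hj.1
    · intro j _; exact Nat.mul_div_cancel_left j hp
    · intro j hj
      simp only [Finset.mem_filter] at hj
      exact Nat.mul_div_cancel' hj.2
    · intro j _; push_cast; ring
  rw [← Finset.sum_filter_add_sum_filter_not (Finset.range (p ^ (r + 1))) (fun j => p ∣ j), hdiv]
  have hp0 := padic_natCast_ne_zero p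
  obtain ⟨m, rfl⟩ : ∃ k, m = k + 1 := ⟨m - 1, by omega⟩
  rw [Nat.add_sub_cancel]
  field_simp
  ring

/-- The carry sum in the multiplication of residues by `c`. -/
def carrySum (c r m : ℕ) : ℤ :=
  ∑ j ∈ Finset.range (p ^ r) with ¬ p ∣ j, ((c * j / p ^ r : ℕ) : ℤ) * ((c : ℤ) * j) ^ (m - 1)

theorem sum_mod_pow_eq {c : ℕ} (hc : c.Coprime p) {r : ℕ} (hr : r ≠ 0) (f : ℕ → ℤ) :
    ∑ j ∈ Finset.range (p ^ r) with ¬ p ∣ j, f (c * j % p ^ r) =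
      ∑ j ∈ Finset.range (p ^ r) with ¬ p ∣ j, f j := by
  have hp : p.Prime := Fact.out
  have hpos : 0 < p ^ r := pow_pos hp.pos r
  have hmaps : Set.MapsTo (fun j => c * j % p ^ r)
      ((Finset.range (p ^ r)).filter (fun j => ¬ p ∣ j) : Finset ℕ)
      ((Finset.range (p ^ r)).filter (fun j => ¬ p ∣ j) : Finset ℕ) := by
    intro j hj
    simp only [Finset.coe_filter, Finset.mem_range, Set.mem_ofPred_eq] at hj ⊢
    refine ⟨Nat.mod_lt _ hpos, fun h => ?_⟩
    rw [Nat.dvd_mod_iff (dvd_pow_self p hr)] at h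
    rcases hp.dvd_mul.1 h with h | h
    · exact hp.one_lt.ne' (Nat.eq_one_of_dvd_coprimes hc h dvd_rfl)
    · exact hj.2 h
  have hinj : Set.InjOn (fun j => c * j % p ^ r)
      ((Finset.range (p ^ r)).filter (fun j => ¬ p ∣ j) : Finset ℕ) := by
    intro a ha b hb hab
    simp only [Finset.coe_filter, Finset.mem_range, Set.mem_ofPred_eq] at ha hb
    have h1 : a ≡ b [MOD p ^ r] :=
      Nat.ModEq.cancel_left_of_coprime (Nat.Coprime.pow_left r hc.symm) hab
    exact Nat.ModEq.eq_of_lt_of_lt h1 ha.1 hb.1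
  refine Finset.sum_nbij (fun j => c * j % p ^ r) (fun j hj => hmaps hj) hinj ?_ (fun _ _ => rfl)
  exact Finset.surjOn_of_injOn_of_card_le _ hmaps hinj le_rfl

/-- Multiplication by `c` permutes the residues prime to `p`. Replacing `c j` by its residue
subtracts `p ^ r` times the carry, and the binomial expansion to first order in `p ^ r` produces
`carrySum`. -/
theorem pow_sub_one_mul_sum_congr {c : ℕ} (hc : c.Coprime p) {r : ℕ} (hr : r ≠ 0) (m : ℕ) :
    ((p : ℤ) ^ r) ^ 2 ∣ ((c : ℤ) ^ m - 1) * ∑ j ∈ Finset.range (p ^ r) with ¬ p ∣ j, (j : ℤ) ^ m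
      - m * (p : ℤ) ^ r * carrySum p c r m := by
  have h := sum_mod_pow_eq p hc hr (fun j => (j : ℤ) ^ m)
  rw [sub_mul, one_mul]
  conv_rhs => enter [1, 2]; rw [← h]
  rw [carrySum, Finset.mul_sum, Finset.mul_sum, ← Finset.sum_sub_distrib, ← Finset.sum_sub_distrib]
  refine Finset.dvd_sum fun j _ => ?_
  obtain ⟨k, hk⟩ := Polynomial.powAddExpansion ((c : ℤ) * j)
    (-((p : ℤ) ^ r * ((c * j / p ^ r : ℕ) : ℤ))) m
  have hmod : ((c * j % p ^ r : ℕ) : ℤ) =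
      (c : ℤ) * j + -((p : ℤ) ^ r * ((c * j / p ^ r : ℕ) : ℤ)) := by
    have := Nat.mod_add_div (c * j) (p ^ r)
    have h2 : ((c * j % p ^ r : ℕ) : ℤ) + (p : ℤ) ^ r * ((c * j / p ^ r : ℕ) : ℤ) = c * j := by
      exact_mod_cast this
    linear_combination h2
  rw [hmod, hk]
  exact ⟨-k * ((c * j / p ^ r : ℕ) : ℤ) ^ 2, by ring⟩

theorem pow_congr_of_congr {a : ℕ} {x : ℤ} (hx : ¬ (p : ℤ) ∣ x) {m m' : ℕ}
    (h : m ≡ m' [MOD (p - 1) * p ^ a]) : x ^ m ≡ x ^ m' [ZMOD (p : ℤ) ^ (a + 1)] := by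
  wlog hle : m ≤ m' generalizing m m'
  · exact (this h.symm (by omega)).symm
  obtain ⟨t, ht⟩ := (Nat.modEq_iff_dvd' hle).1 h
  obtain rfl : m' = m + (p - 1) * p ^ a * t := by omega
  have hp : p.Prime := Fact.out
  have hcop : IsCoprime x ((p ^ (a + 1) : ℕ) : ℤ) := by
    push_cast
    exact (IsCoprime.pow_left ((Nat.prime_iff_prime_int.1 hp).coprime_iff_not_dvd.2 hx)).symm
  have h1 : x ^ ((p - 1) * p ^ a) ≡ 1 [ZMOD (p : ℤ) ^ (a + 1)] := by
    have h2 : (ZMod.unitOfIsCoprime x hcop) ^ (Nat.totient (p ^ (a + 1))) = 1 :=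
      ZMod.pow_totient _
    have h3 := congrArg (Units.val) h2
    rw [Units.val_pow_eq_pow_val, ZMod.coe_unitOfIsCoprime, Units.val_one,
      Nat.totient_prime_pow_succ hp, mul_comm] at h3
    have h4 : ((x ^ ((p - 1) * p ^ a) : ℤ) : ZMod (p ^ (a + 1))) = ((1 : ℤ) : ZMod (p ^ (a + 1))) := by
      push_cast; exact h3
    have := (ZMod.intCast_eq_intCast_iff _ _ _).1 h4
    push_cast at this
    exact this
  rw [pow_add x, pow_mul x]
  simpa using ((h1.pow t).mul_left (x ^ m)).symm

theorem carrySum_congr {c : ℕ} (hc : c.Coprime p) {a r m m' : ℕ} (hm : 1 ≤ m) (hm' : 1 ≤ m')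
    (h : m ≡ m' [MOD (p - 1) * p ^ a]) :
    carrySum p c r m ≡ carrySum p c r m' [ZMOD (p : ℤ) ^ (a + 1)] := by
  refine Int.ModEq.sum fun j hj => Int.ModEq.mul_left _ (pow_congr_of_congr p ?_ ?_)
  · rw [Finset.mem_filter] at hj
    have hp : p.Prime := Fact.out
    rw [← Nat.cast_mul, Int.natCast_dvd_natCast, hp.dvd_mul, not_or]
    refine ⟨fun h => ?_, hj.2⟩
    exact hp.one_lt.ne' (Nat.eq_one_of_dvd_coprimes hc h dvd_rfl)
  · refine Nat.ModEq.add_right_cancel' 1 ?_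
    rwa [Nat.sub_add_cancel hm, Nat.sub_add_cancel hm']

end PowerSums

/-! ### Kummer congruences -/

section Kummer

variable (p : ℕ) [Fact p.Prime]

/-- After division by `m p ^ r`, the congruence modulo `p ^ (2 r)` leaves an error `p ^ r z / m`,
which tends to zero. The regularized Bernoulli number is thus a limit of integers depending on `m`
only through powers of units. -/
theorem tendsto_carrySum {c : ℕ} (hc : c.Coprime p) {m : ℕ} (hm : 1 ≤ m) :
    Tendsto (fun r : ℕ => ((carrySum p c r m : ℤ) : ℚ_[p])) atTop
      (𝓝 (((c : ℚ_[p]) ^ m - 1) *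
        ((1 - (p : ℚ_[p]) ^ (m - 1)) * ((bernoulli m : ℚ) : ℚ_[p]) / m))) := by
  have h1 := ((tendsto_sum_coprime_pow_div p hm).div_const (m : ℚ_[p])).const_mul
    ((c : ℚ_[p]) ^ m - 1)
  have hd : ∀ r : ℕ, ∃ z : ℤ, r ≠ 0 → ((c : ℤ) ^ m - 1) *
      ∑ j ∈ Finset.range (p ^ r) with ¬ p ∣ j, (j : ℤ) ^ m - m * (p : ℤ) ^ r * carrySum p c r m =
      ((p : ℤ) ^ r) ^ 2 * z := by
    intro r
    rcases eq_or_ne r 0 with h | h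
    · exact ⟨0, fun h' => absurd h h'⟩
    · obtain ⟨z, hz⟩ := pow_sub_one_mul_sum_congr p hc h m
      exact ⟨z, fun _ => hz⟩
  choose z hz using hd
  have h2 : Tendsto (fun r : ℕ => (p : ℚ_[p]) ^ r * ((z r : ℤ) : ℚ_[p]) / m) atTop (𝓝 0) := by
    rw [← zero_div (m : ℚ_[p])]
    refine Tendsto.div_const ?_ _
    refine squeeze_zero_norm (a := fun r => ‖(p : ℚ_[p]) ^ r‖) (fun r => ?_) ?_
    · rw [norm_mul]
      exact mul_le_of_le_one_right (norm_nonneg _) (Padic.norm_int_le_one _)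
    · simpa using (tendsto_natCast_pow_atTop p).norm
  have h3 := h1.sub h2
  rw [sub_zero] at h3
  refine h3.congr' ?_
  filter_upwards [eventually_ne_atTop 0] with r hr
  have h4 := congrArg (fun q : ℤ => (q : ℚ_[p])) (hz r hr)
  push_cast at h4
  have hp := pow_ne_zero r (padic_natCast_ne_zero p)
  have hm' : (m : ℚ_[p]) ≠ 0 := by exact_mod_cast (show m ≠ 0 by omega)
  field_simp
  linear_combination h4

/-- The regularized values satisfy the Kummer congruences. -/
theorem norm_regularized_sub_le {c : ℕ} (hc : c.Coprime p) {a m m' : ℕ} (hm : 1 ≤ m) (hm' : 1 ≤ m')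
    (h : m ≡ m' [MOD (p - 1) * p ^ a]) :
    ‖((c : ℚ_[p]) ^ m - 1) * ((1 - (p : ℚ_[p]) ^ (m - 1)) * ((bernoulli m : ℚ) : ℚ_[p]) / m)
      - ((c : ℚ_[p]) ^ m' - 1) *
        ((1 - (p : ℚ_[p]) ^ (m' - 1)) * ((bernoulli m' : ℚ) : ℚ_[p]) / m')‖ ≤
      (p : ℝ) ^ (-((a + 1 : ℕ) : ℤ)) := by
  refine le_of_tendsto ((tendsto_carrySum p hc hm).sub (tendsto_carrySum p hc hm')).norm
    (Eventually.of_forall fun r => ?_)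
  rw [← Int.cast_sub, Padic.norm_int_le_pow_iff_dvd]
  have := (carrySum_congr p hc (r := r) hm hm' h).symm.dvd
  exact_mod_cast this

theorem norm_regularized_le_one {c : ℕ} (hc : c.Coprime p) {m : ℕ} (hm : 1 ≤ m) :
    ‖((c : ℚ_[p]) ^ m - 1) *
      ((1 - (p : ℚ_[p]) ^ (m - 1)) * ((bernoulli m : ℚ) : ℚ_[p]) / m)‖ ≤ 1 :=
  le_of_tendsto (tendsto_carrySum p hc hm).norm
    (Eventually.of_forall fun _ => Padic.norm_int_le_one _)

theorem norm_one_add_pow_sub_one {m : ℕ} (hm : ¬ p ∣ m) :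
    ‖(((1 + p : ℕ) : ℚ_[p])) ^ m - 1‖ = (p : ℝ)⁻¹ := by
  obtain ⟨k, hk⟩ := Polynomial.powAddExpansion (1 : ℤ) (p : ℤ) m
  have h1 : (((1 + p : ℕ) : ℚ_[p])) ^ m - 1 = p * ((m + k * p : ℤ) : ℚ_[p]) := by
    have := congrArg (fun q : ℤ => (q : ℚ_[p])) hk
    push_cast at this ⊢
    rw [this]
    ring
  rw [h1, norm_mul, Padic.norm_p]
  have h2 : ‖((m + k * p : ℤ) : ℚ_[p])‖ = 1 := by
    refine le_antisymm (Padic.norm_int_le_one _) (not_lt.1 fun h => hm ?_)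
    rw [Padic.norm_intCast_lt_one_iff] at h
    have h3 := (Int.dvd_add_left (dvd_mul_left (p : ℤ) k)).1 h
    exact_mod_cast h3
  rw [h2, mul_one]

/-- The Kummer congruences for `(1 - p ^ (m - 1)) B_m / m`, with a loss of one digit. -/
theorem norm_bernoulli_div_sub_le {a m m' : ℕ} (hm : ¬ p ∣ m) (hm' : ¬ p ∣ m')
    (h : m ≡ m' [MOD (p - 1) * p ^ a]) :
    ‖(1 - (p : ℚ_[p]) ^ (m - 1)) * ((bernoulli m : ℚ) : ℚ_[p]) / m
      - (1 - (p : ℚ_[p]) ^ (m' - 1)) * ((bernoulli m' : ℚ) : ℚ_[p]) / m'‖ ≤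
      (p : ℝ) ^ (-((a : ℤ) - 1)) := by
  have hp1 : (1 : ℝ) < p := by exact_mod_cast (Fact.out : p.Prime).one_lt
  have hp0 : (0 : ℝ) < p := by linarith
  have hpos : 1 ≤ m := Nat.one_le_iff_ne_zero.2 fun h => hm (h ▸ dvd_zero p)
  have hpos' : 1 ≤ m' := Nat.one_le_iff_ne_zero.2 fun h => hm' (h ▸ dvd_zero p)
  -- For `c = 1 + p` the factor `c ^ m - 1` has norm exactly `1 / p` in every residue class of `m`
  -- modulo `p - 1`. This includes multiples of `p - 1`, where no `c` prime to `p` makes it a unit;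
  -- that case is needed for `ζ_7(7)`.
  have hc : (1 + p).Coprime p := by simp
  have k1 := norm_regularized_sub_le p hc hpos hpos' h
  have k2 := norm_regularized_le_one p hc hpos'
  have d1 := norm_one_add_pow_sub_one p hm
  have d2 := norm_one_add_pow_sub_one p hm'
  have k3 : ‖(((1 + p : ℕ) : ℚ_[p])) ^ m' - (((1 + p : ℕ) : ℚ_[p])) ^ m‖ ≤
      (p : ℝ) ^ (-((a + 1 : ℕ) : ℤ)) := by
    have : ¬ (p : ℤ) ∣ ((1 + p : ℕ) : ℤ) := by
      rw [Int.natCast_dvd_natCast, Nat.dvd_add_left dvd_rfl, Nat.dvd_one]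
      exact (Fact.out : p.Prime).one_lt.ne'
    have h' := (pow_congr_of_congr p this h).dvd
    rw [← Nat.cast_pow, ← Nat.cast_pow, ← Int.cast_natCast, ← Int.cast_natCast (R := ℚ_[p]) (_ ^ m),
      ← Int.cast_sub, Padic.norm_int_le_pow_iff_dvd]
    exact_mod_cast h'
  generalize (1 - (p : ℚ_[p]) ^ (m - 1)) * ((bernoulli m : ℚ) : ℚ_[p]) / m = u at *
  generalize (1 - (p : ℚ_[p]) ^ (m' - 1)) * ((bernoulli m' : ℚ) : ℚ_[p]) / m' = u' at *
  generalize (((1 + p : ℕ) : ℚ_[p])) ^ m = D at *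
  generalize (((1 + p : ℕ) : ℚ_[p])) ^ m' = D' at *
  have e : (D - 1) * ((D' - 1) * (u - u')) =
      (D' - 1) * ((D - 1) * u - (D' - 1) * u') + (D' - D) * ((D' - 1) * u') := by ring
  have n1 : ‖(D - 1) * ((D' - 1) * (u - u'))‖ ≤ (p : ℝ) ^ (-((a + 1 : ℕ) : ℤ)) := by
    rw [e]
    refine (Padic.nonarchimedean _ _).trans (max_le ?_ ?_)
    · rw [norm_mul, d2]
      refine (mul_le_of_le_one_left (norm_nonneg _) ?_).trans k1
      exact inv_le_one_of_one_le₀ hp1.le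
    · rw [norm_mul]
      exact (mul_le_of_le_one_right (norm_nonneg _) k2).trans k3
  rw [norm_mul, norm_mul, d1, d2] at n1
  have e2 : (p : ℝ) ^ (-((a : ℤ) - 1)) = p * (p * (p : ℝ) ^ (-((a + 1 : ℕ) : ℤ))) := by
    rw [← zpow_one_add₀ hp0.ne', ← zpow_one_add₀ hp0.ne']
    congr 1; push_cast; ring
  rw [e2]
  have := mul_le_mul_of_nonneg_left n1 (by positivity : (0 : ℝ) ≤ p * p)
  field_simp at this
  linarith

end Kummer

/-! ### Existence of the zeta values and Bernoulli limits -/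

section ZetaLimit

variable (p : ℕ) [Fact p.Prime]

theorem eulerRemovedZeta_one_sub {m : ℕ} (hm : 1 ≤ m) (he : Even m) :
    eulerRemovedZeta p (1 - m) =
      -((1 - (p : ℚ_[p]) ^ (m - 1)) * ((bernoulli m : ℚ) : ℚ_[p]) / m) := by
  obtain ⟨j, rfl⟩ : ∃ j, m = j + 1 := ⟨m - 1, by omega⟩
  have hodd : Odd j := by
    rw [← Nat.not_even_iff_odd]; exact fun h => (Nat.even_add_one.1 he) h
  have h : -(1 - ((j + 1 : ℕ) : ℤ)) = (j : ℤ) := by push_cast; ring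
  rw [eulerRemovedZeta, zetaNonpos, h, Int.toNat_natCast, zpow_natCast, hodd.neg_one_pow,
    Nat.add_sub_cancel]
  push_cast
  ring

theorem exists_tendsto_eulerRemovedZeta (hp : p ≠ 2) {k : ℤ} (hk : Odd k)
    (hpk : ¬ (p : ℤ) ∣ k - 1) :
    ∃ L, Tendsto (eulerRemovedZeta p) (padicZetaFilter p k) (𝓝 L) := by
  have hpp : p.Prime := Fact.out
  have hp1 : (1 : ℝ) < p := by exact_mod_cast hpp.one_lt
  have hodd : Odd p := hpp.odd_of_ne_two hp
  have := padicZetaFilter_neBot p k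
  suffices h : Cauchy (map (eulerRemovedZeta p) (padicZetaFilter p k)) from
    CompleteSpace.complete h
  rw [Metric.cauchy_iff]
  refine ⟨inferInstance, fun ε hε => ?_⟩
  obtain ⟨b, hb⟩ : ∃ b : ℕ, ((p : ℝ)⁻¹) ^ b < ε :=
    exists_pow_lt_of_lt_one hε (inv_lt_one_of_one_lt₀ hp1)
  -- The exponent `b + 1` offsets the digit lost in `norm_bernoulli_div_sub_le`.
  set s : Set ℤ := {n | n ≤ -1 ∧ n ≡ k [ZMOD ((p : ℤ) - 1)] ∧ n ≡ k [ZMOD (p : ℤ) ^ (b + 1)]}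
    with hs
  have hmem : s ∈ padicZetaFilter p k := by
    have h1 : ∀ᶠ n : ℤ in padicZetaFilter p k, n ≤ -1 :=
      (eventually_le_atBot (-1 : ℤ)).filter_mono (inf_le_left.trans inf_le_left)
    have h2 : ∀ᶠ n : ℤ in padicZetaFilter p k, n ≡ k [ZMOD ((p : ℤ) - 1)] :=
      Eventually.filter_mono (inf_le_left.trans inf_le_right)
        (mem_principal_self {n : ℤ | n ≡ k [ZMOD ((p : ℤ) - 1)]})
    have h3 : ∀ᶠ n : ℤ in padicZetaFilter p k, n ≡ k [ZMOD (p : ℤ) ^ (b + 1)] := by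
      have : ∀ᶠ x : ℚ_[p] in 𝓝 (k : ℚ_[p]), ‖x - k‖ < (p : ℝ) ^ (-((b + 1 : ℕ) : ℤ)) := by
        have hpos : (0 : ℝ) < (p : ℝ) ^ (-((b + 1 : ℕ) : ℤ)) := zpow_pos (by linarith) _
        filter_upwards [Metric.ball_mem_nhds (k : ℚ_[p]) hpos] with x hx
        rwa [← dist_eq_norm]
      have h4 := (tendsto_comap.eventually this).filter_mono
        (inf_le_right : padicZetaFilter p k ≤ _)
      filter_upwards [h4] with n hn
      rw [← Int.cast_sub] at hn
      have h5 := (Padic.norm_int_le_pow_iff_dvd _ _).1 hn.le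
      exact (Int.modEq_iff_dvd.2 (by exact_mod_cast h5)).symm
    filter_upwards [h1, h2, h3] with n a1 a2 a3 using ⟨a1, a2, a3⟩
  refine ⟨eulerRemovedZeta p '' s, image_mem_map hmem, ?_⟩
  have key : ∀ n ∈ s, ∃ m : ℕ, 1 ≤ m ∧ Even m ∧ ¬ p ∣ m ∧ n = 1 - (m : ℤ) := by
    rintro n ⟨h1, h2, h3⟩
    refine ⟨(1 - n).toNat, by omega, ?_, ?_, by omega⟩
    · have h4 : (2 : ℤ) ∣ (p : ℤ) - 1 := by
        obtain ⟨t, ht⟩ := hodd; exact ⟨t, by rw [ht]; push_cast; ring⟩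
      have h5 := (h2.of_dvd h4).dvd
      obtain ⟨t, ht⟩ := hk
      rw [Nat.even_iff]
      omega
    · intro h
      apply hpk
      have h4 : (p : ℤ) ∣ 1 - n := by
        have := Int.natCast_dvd_natCast.2 h
        rwa [Int.toNat_of_nonneg (by omega)] at this
      have h5 : (p : ℤ) ∣ k - n := (dvd_pow_self (p : ℤ) (Nat.succ_ne_zero b)).trans h3.dvd
      have := dvd_sub h5 h4
      rwa [show k - n - (1 - n) = k - 1 by ring] at this
  rintro _ ⟨n, hn, rfl⟩ _ ⟨n', hn', rfl⟩
  obtain ⟨m, m1, m2, m3, m4⟩ := key n hn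
  obtain ⟨m', m1', m2', m3', m4'⟩ := key n' hn'
  have hcongr : m ≡ m' [MOD (p - 1) * p ^ (b + 1)] := by
    have hcop : (p - 1).Coprime (p ^ (b + 1)) := by
      refine Nat.Coprime.pow_right _ ?_
      exact (Nat.coprime_of_lt_prime (by have := hpp.two_le; omega)
        (by have := hpp.two_le; omega) hpp).symm
    have e : ∀ N : ℤ, n ≡ n' [ZMOD N] → (m : ℤ) ≡ m' [ZMOD N] := fun N h => by
      have := (Int.ModEq.refl (1 : ℤ)).sub h
      rwa [m4, m4', sub_sub_cancel, sub_sub_cancel] at this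
    refine (Nat.modEq_and_modEq_iff_modEq_mul hcop).1 ⟨?_, ?_⟩
    · rw [← Int.natCast_modEq_iff, Nat.cast_sub hpp.one_lt.le]
      exact e _ (hn.2.1.trans hn'.2.1.symm)
    · rw [← Int.natCast_modEq_iff, Nat.cast_pow]
      exact e _ (hn.2.2.trans hn'.2.2.symm)
  have hfin := norm_bernoulli_div_sub_le p m3 m3' hcongr
  rw [dist_eq_norm, m4, m4', eulerRemovedZeta_one_sub p m1 m2, eulerRemovedZeta_one_sub p m1' m2',
    neg_sub_neg, norm_sub_rev]
  refine hfin.trans_lt (lt_of_eq_of_lt ?_ hb)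
  rw [← zpow_natCast, inv_zpow']
  congr 1
  push_cast
  ring

theorem tendsto_padicZeta (hp : p ≠ 2) {k : ℤ} (hk : Odd k) (hpk : ¬ (p : ℤ) ∣ k - 1) :
    Tendsto (eulerRemovedZeta p) (padicZetaFilter p k) (𝓝 (padicZeta p k)) :=
  tendsto_nhds_limUnder (exists_tendsto_eulerRemovedZeta p hp hk hpk)

/-- A sequence of exponents that tends to `0` `p`-adically and is divisible by `p - 1`. -/
def zeroSeq (r : ℕ) : ℕ := (p - 1) * p ^ r

theorem tendsto_zeroSeq_atTop : Tendsto (zeroSeq p) atTop atTop := by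
  have hp : p.Prime := Fact.out
  refine tendsto_atTop_mono (fun r => ?_) tendsto_id
  have h1 : r < p ^ r := Nat.lt_pow_self hp.one_lt
  have h2 : 1 * p ^ r ≤ (p - 1) * p ^ r := Nat.mul_le_mul_right _ (by have := hp.two_le; omega)
  simp only [zeroSeq, id]
  omega

theorem tendsto_natCast_zeroSeq :
    Tendsto (fun r => ((zeroSeq p r : ℕ) : ℚ_[p])) atTop (𝓝 0) := by
  have h := (tendsto_natCast_pow_atTop p).const_mul (((p - 1 : ℕ) : ℚ_[p]))
  rw [mul_zero] at h
  refine h.congr fun r => ?_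
  simp [zeroSeq]

theorem tendsto_sub_zeroSeq (k : ℤ) :
    Tendsto (fun r => k - (zeroSeq p r : ℤ)) atTop (padicZetaFilter p k) := by
  have hp : p.Prime := Fact.out
  refine tendsto_inf.2 ⟨tendsto_inf.2 ⟨?_, ?_⟩, ?_⟩
  · exact tendsto_atBot_add_const_left _ k (tendsto_neg_atTop_atBot.comp
      (tendsto_natCast_atTop_atTop.comp (tendsto_zeroSeq_atTop p)))
  · refine tendsto_principal.2 (Eventually.of_forall fun r => Int.modEq_iff_dvd.2 ?_)
    refine ⟨(p : ℤ) ^ r, ?_⟩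
    rw [zeroSeq, Nat.cast_mul, Nat.cast_sub hp.one_lt.le]
    push_cast
    ring
  · refine tendsto_comap_iff.2 ?_
    have h := (tendsto_natCast_zeroSeq p).const_sub (k : ℚ_[p])
    rw [sub_zero] at h
    refine h.congr fun r => ?_
    simp

theorem even_zeroSeq (hp : p ≠ 2) (r : ℕ) : Even (zeroSeq p r) :=
  Even.mul_right (((Fact.out : p.Prime).odd_of_ne_two hp).tsub_odd odd_one) _

/-- Bernoulli numbers converge to multiples of `p`-adic zeta values. -/
theorem tendsto_bernoulli_zeroSeq_sub (hp : p ≠ 2) {l : ℕ} (hl : Even l) (hpl : ¬ p ∣ l) :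
    Tendsto (fun r => ((bernoulli (zeroSeq p r - l) : ℚ) : ℚ_[p])) atTop
      (𝓝 (l * padicZeta p (l + 1))) := by
  have hodd : Odd ((l : ℤ) + 1) := by
    obtain ⟨t, ht⟩ := hl; exact ⟨t, by rw [ht]; push_cast; ring⟩
  have h1 := (tendsto_padicZeta p hp hodd
    (by rwa [add_sub_cancel_right, Int.natCast_dvd_natCast])).comp (tendsto_sub_zeroSeq p (l + 1))
  have h2 := (tendsto_natCast_zeroSeq p).const_sub (l : ℚ_[p])
  rw [sub_zero] at h2
  have h3 : Tendsto (fun r => (1 - (p : ℚ_[p]) ^ (zeroSeq p r - (l + 1)))⁻¹) atTop (𝓝 1) := by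
    have h := ((tendsto_natCast_pow_atTop p).comp
      ((tendsto_sub_atTop_nat (l + 1)).comp (tendsto_zeroSeq_atTop p))).const_sub 1
    rw [sub_zero] at h
    simpa using h.inv₀ (by simp)
  -- With `m = zeroSeq p r - l`, the number `B_m` is `-m` times the zeta value at `1 - m`, divided
  -- by `1 - p ^ (m - 1)`; these factors tend to `l`, `ζ_p(l + 1)` and `1`.
  have h4 := (h2.mul h1).mul h3
  rw [mul_one] at h4
  refine h4.congr' ?_
  filter_upwards [(tendsto_zeroSeq_atTop p).eventually_ge_atTop (l + 2)] with r hr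
  have he : Even (zeroSeq p r - l) := (even_zeroSeq p hp r).tsub hl
  have h5 := eulerRemovedZeta_one_sub p (show 1 ≤ zeroSeq p r - l by omega) he
  have h6 : (1 : ℤ) - ((zeroSeq p r - l : ℕ) : ℤ) = (l : ℤ) + 1 - zeroSeq p r := by omega
  rw [h6] at h5
  simp only [Function.comp]
  rw [h5, show zeroSeq p r - l - 1 = zeroSeq p r - (l + 1) by omega]
  have hne : (1 - (p : ℚ_[p]) ^ (zeroSeq p r - (l + 1))) ≠ 0 := by
    intro h
    have h7 : ‖(p : ℚ_[p]) ^ (zeroSeq p r - (l + 1))‖ = 1 := by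
      rw [← sub_eq_zero.1 h, norm_one]
    rw [norm_pow] at h7
    exact absurd h7 (pow_lt_one₀ (norm_nonneg _) Padic.norm_p_lt_one (by omega)).ne
  have hm : ((zeroSeq p r - l : ℕ) : ℚ_[p]) ≠ 0 := by
    exact_mod_cast (show zeroSeq p r - l ≠ 0 by omega)
  have h8 : ((zeroSeq p r - l : ℕ) : ℚ_[p]) = zeroSeq p r - l := Nat.cast_sub (by omega)
  have h9 : (l : ℚ_[p]) - zeroSeq p r = -((zeroSeq p r - l : ℕ) : ℚ_[p]) := by rw [h8]; ring
  rw [h9]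
  field_simp

end ZetaLimit

/-! ### Harmonic sums through Faulhaber's formula -/

section HarmonicSums

variable (p : ℕ) [Fact p.Prime]

theorem norm_primeInv_le {q : ℕ} (hq : q.Prime) : ‖((q : ℚ_[p]))⁻¹‖ ≤ p := by
  have hp : p.Prime := Fact.out
  have h1 : (1 : ℝ) ≤ p := by exact_mod_cast hp.one_lt.le
  rcases eq_or_ne q p with rfl | h
  · rw [norm_inv, Padic.norm_p, inv_inv]
  · rw [norm_inv, (Padic.norm_natCast_eq_one_iff).2 ((Nat.coprime_primes hp hq).2 h.symm), inv_one]
    exact h1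

theorem bernoulli_two_mul_eq (k : ℕ) : ∃ z : ℤ, ((bernoulli (2 * k) : ℚ) : ℚ_[p]) =
    z - ∑ q ∈ Finset.range (2 * k + 2) with q.Prime ∧ (q - 1) ∣ 2 * k, ((q : ℚ_[p]))⁻¹ := by
  obtain ⟨z, hz⟩ := Bernoulli.vonStaudt_clausen k
  refine ⟨z, ?_⟩
  have h := congrArg (fun q : ℚ => (q : ℚ_[p])) hz
  push_cast at h
  simp only [one_div] at h
  rw [h]; ring

theorem norm_bernoulli_le (hp2 : p ≠ 2) (i : ℕ) : ‖((bernoulli i : ℚ) : ℚ_[p])‖ ≤ p := by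
  have hp : p.Prime := Fact.out
  have h1 : (1 : ℝ) ≤ p := by exact_mod_cast hp.one_lt.le
  rcases Nat.even_or_odd' i with ⟨k, rfl | rfl⟩
  · obtain ⟨z, hz⟩ := bernoulli_two_mul_eq p k
    rw [hz, sub_eq_add_neg]
    refine (Padic.nonarchimedean _ _).trans (max_le ((Padic.norm_int_le_one z).trans h1) ?_)
    rw [norm_neg]
    refine IsUltrametricDist.norm_sum_le_of_forall_le_of_nonneg (by linarith) fun q hq => ?_
    exact norm_primeInv_le p (Finset.mem_filter.1 hq).2.1
  · rcases Nat.eq_zero_or_pos k with rfl | hk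
    · have h2 : ‖(2 : ℚ_[p])‖ = 1 := by
        have := (Padic.norm_natCast_eq_one_iff (p := p) (n := 2)).2
          ((Nat.coprime_primes hp Nat.prime_two).2 hp2)
        exact_mod_cast this
      rw [show 2 * 0 + 1 = 1 by norm_num, bernoulli_one]
      push_cast
      rw [norm_div, norm_neg, norm_one, h2]
      simpa using h1
    · rw [bernoulli_eq_zero_of_odd ⟨k, rfl⟩ (by omega)]
      simp

theorem norm_bernoulli_le_one {i : ℕ} (hi : Even i) (h : ¬ (p - 1) ∣ i) :
    ‖((bernoulli i : ℚ) : ℚ_[p])‖ ≤ 1 := by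
  have hp : p.Prime := Fact.out
  obtain ⟨k, rfl⟩ := hi.two_dvd
  obtain ⟨z, hz⟩ := bernoulli_two_mul_eq p k
  rw [hz, sub_eq_add_neg]
  refine (Padic.nonarchimedean _ _).trans (max_le (Padic.norm_int_le_one z) ?_)
  rw [norm_neg]
  refine IsUltrametricDist.norm_sum_le_of_forall_le_of_nonneg zero_le_one fun q hq => ?_
  obtain ⟨-, h1, h2⟩ := Finset.mem_filter.1 hq
  have hqp : p ≠ q := by rintro rfl; exact h h2
  rw [norm_inv, (Padic.norm_natCast_eq_one_iff).2 ((Nat.coprime_primes hp h1).2 hqp), inv_one]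

theorem norm_inv_natCast_le {n d : ℕ} (hn : n ≠ 0) (h : n < p ^ (d + 1)) :
    ‖((n : ℚ_[p]))⁻¹‖ ≤ (p : ℝ) ^ d := by
  have hp : p.Prime := Fact.out
  have h1 : (1 : ℝ) ≤ p := by exact_mod_cast hp.one_lt.le
  have h0 : (n : ℚ_[p]) ≠ 0 := by exact_mod_cast hn
  rw [norm_inv, Padic.norm_eq_zpow_neg_valuation h0, Padic.valuation_natCast, zpow_neg, inv_inv,
    zpow_natCast]
  refine pow_le_pow_right₀ h1 ?_
  have h2 : p ^ padicValNat p n ≤ n := Nat.le_of_dvd (Nat.pos_of_ne_zero hn) pow_padicValNat_dvd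
  have h3 := (Nat.pow_lt_pow_iff_right hp.one_lt).1 (h2.trans_lt h)
  omega

/-- Indexing by the distance `t` of the Bernoulli index from `m` makes a termwise limit in `m`
possible. -/
theorem sum_range_pow_reflect (n m : ℕ) : (∑ j ∈ Finset.range n, (j : ℚ) ^ m) =
    ∑ t ∈ Finset.range (m + 1),
      bernoulli (m - t) * (m.choose t) * (n : ℚ) ^ (t + 1) / (t + 1) := by
  rw [sum_range_pow, ← Finset.sum_range_reflect]
  refine Finset.sum_congr rfl fun t ht => ?_
  rw [Finset.mem_range] at ht
  rw [show m + 1 - 1 - t = m - t by omega, show m + 1 - (m - t) = t + 1 by omega]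
  have h1 : (((m + 1).choose (m - t) : ℕ) : ℚ) * (t + 1) = (m + 1) * m.choose t := by
    have h2 : (m + 1).choose (m - t) = (m + 1).choose (t + 1) := by
      rw [← Nat.choose_symm (show t + 1 ≤ m + 1 by omega)]
      congr 1
      omega
    have h3 := Nat.add_one_mul_choose_eq m t
    rw [h2]
    exact_mod_cast h3.symm
  have h4 : (m : ℚ) + 1 ≠ 0 := by positivity
  have h5 : (t : ℚ) + 1 ≠ 0 := by positivity
  field_simp
  linear_combination (bernoulli (m - t)) * (n : ℚ) * (n : ℚ) ^ t * h1

/-- The `t`-th term of Faulhaber's formula for `p ^ s ∑_{j < p} j ^ (N - s)`. -/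
noncomputable def faulhaberTerm (s N t : ℕ) : ℚ_[p] :=
  (p : ℚ_[p]) ^ s * (((bernoulli (N - s - t) : ℚ) : ℚ_[p]) * ((N - s).choose t)
    * (p : ℚ_[p]) ^ (t + 1) / (t + 1))

theorem mul_sum_range_pow_eq (s N : ℕ) :
    (p : ℚ_[p]) ^ s * ∑ j ∈ Finset.range p, (j : ℚ_[p]) ^ (N - s) =
      ∑ t ∈ Finset.range (N - s + 1), faulhaberTerm p s N t := by
  have h := congrArg (fun q : ℚ => (q : ℚ_[p])) (sum_range_pow_reflect p (N - s))
  push_cast at h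
  rw [h, Finset.mul_sum]
  rfl

/-- The explicit power is `p ^ (s + t + 1)`, against which stand the denominators of the Bernoulli
number and of `1 / (t + 1)`. For `s + t = 8` the former is absent, since `p - 1` does not divide
`8`, and the latter costs at most one digit. For `s + t = 8 + d` with `d > 0` they cost at most `1`
and `d` digits. -/
theorem norm_faulhaberTerm_le (hp : 7 ≤ p) {s t r : ℕ} (hs : 2 ≤ s) (hst : 8 ≤ s + t)
    (hN : s + t ≤ zeroSeq p r) : ‖faulhaberTerm p s (zeroSeq p r) t‖ ≤ ((p : ℝ)⁻¹) ^ 8 := by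
  have hpp : p.Prime := Fact.out
  have hp0 : (0 : ℝ) < p := by exact_mod_cast hpp.pos
  have hC : ‖(((zeroSeq p r - s).choose t : ℕ) : ℚ_[p])‖ ≤ 1 := by
    exact_mod_cast Padic.norm_int_le_one (p := p) ((zeroSeq p r - s).choose t)
  have hform : ‖faulhaberTerm p s (zeroSeq p r) t‖ =
      ((p : ℝ)⁻¹) ^ (s + t + 1) * ‖((bernoulli (zeroSeq p r - s - t) : ℚ) : ℚ_[p])‖ *
        ‖(((zeroSeq p r - s).choose t : ℕ) : ℚ_[p])‖ * ‖(((t + 1 : ℕ) : ℚ_[p]))⁻¹‖ := by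
    rw [faulhaberTerm, norm_mul, norm_div, norm_mul, norm_mul, norm_pow, norm_pow, Padic.norm_p,
      norm_inv]
    push_cast
    ring
  have hbound : ∀ A C : ℝ, 0 ≤ A →
      ‖((bernoulli (zeroSeq p r - s - t) : ℚ) : ℚ_[p])‖ ≤ A →
      ‖(((t + 1 : ℕ) : ℚ_[p]))⁻¹‖ ≤ C →
      ‖faulhaberTerm p s (zeroSeq p r) t‖ ≤ ((p : ℝ)⁻¹) ^ (s + t + 1) * (A * C) := by
    intro A C hA0 hA hC'
    rw [hform, mul_assoc, mul_assoc]
    refine mul_le_mul_of_nonneg_left ?_ (by positivity)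
    refine mul_le_mul hA ?_ (by positivity) hA0
    exact (mul_le_of_le_one_left (norm_nonneg _) hC).trans hC'
  obtain ⟨d, hd⟩ : ∃ d, s + t = 8 + d := ⟨s + t - 8, by omega⟩
  rcases Nat.eq_zero_or_pos d with rfl | hd0
  · have hB : ‖((bernoulli (zeroSeq p r - s - t) : ℚ) : ℚ_[p])‖ ≤ 1 := by
      rw [show zeroSeq p r - s - t = zeroSeq p r - 8 by omega]
      refine norm_bernoulli_le_one p ((even_zeroSeq p (by omega) r).tsub (by decide)) fun h => ?_
      have h1 : (p - 1) ∣ zeroSeq p r := dvd_mul_right _ _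
      have h2 : (p - 1) ∣ 8 := by
        have := Nat.dvd_sub h1 h
        rwa [show zeroSeq p r - (zeroSeq p r - 8) = 8 by omega] at this
      have h3 := Nat.le_of_dvd (by norm_num) h2
      obtain rfl | rfl | rfl : p = 7 ∨ p = 8 ∨ p = 9 := by omega
      · norm_num at h2
      · norm_num at h2
      · norm_num at hpp
    have hI := norm_inv_natCast_le p (n := t + 1) (d := 1) (by omega) (by
      calc t + 1 ≤ 7 := by omega
        _ < 7 ^ 2 := by norm_num
        _ ≤ p ^ 2 := Nat.pow_le_pow_left hp 2)
    refine (hbound 1 _ zero_le_one hB hI).trans (le_of_eq ?_)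
    rw [hd, one_mul, pow_one, Nat.add_zero, pow_succ _ 8, mul_assoc, inv_mul_cancel₀ hp0.ne', mul_one]
  · have hI := norm_inv_natCast_le p (n := t + 1) (d := d) (by omega) (by
      have h1 : ∀ d : ℕ, 1 ≤ d → d + 7 < 7 ^ (d + 1) := by
        intro d hd
        induction d, hd using Nat.le_induction with
        | base => norm_num
        | succ d _ ih => rw [pow_succ]; omega
      calc t + 1 ≤ d + 7 := by omega
        _ < 7 ^ (d + 1) := h1 d hd0
        _ ≤ p ^ (d + 1) := Nat.pow_le_pow_left hp _)
    refine (hbound p _ hp0.le (norm_bernoulli_le p (by omega) _) hI).trans (le_of_eq ?_)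
    rw [hd, show 8 + d + 1 = 8 + (d + 1) by ring, pow_add _ 8, mul_assoc, ← pow_succ', ← mul_pow,
      inv_mul_cancel₀ hp0.ne', one_pow, mul_one]

/-- By Euler's theorem `k ^ zeroSeq p r` tends to `1` for `k` prime to `p`; the summand `j = 0` is
zero once the exponent is positive. -/
theorem tendsto_sum_range_pow {w : ℕ → ℤ_[p]}
    (hw : ∀ k ∈ Finset.Icc 1 (p - 1), (k : ℤ_[p]) * w k = 1) (s : ℕ) :
    Tendsto (fun r => ∑ j ∈ Finset.range p, (j : ℚ_[p]) ^ (zeroSeq p r - s)) atTop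
      (𝓝 (∑ k ∈ Finset.Icc 1 (p - 1), ((w k : ℤ_[p]) : ℚ_[p]) ^ s)) := by
  have hpp : p.Prime := Fact.out
  have hr : Finset.range p = insert 0 (Finset.Icc 1 (p - 1)) := by
    have := hpp.pos
    ext k; simp only [Finset.mem_range, Finset.mem_insert, Finset.mem_Icc]; omega
  have h1 : Tendsto (fun r => ∑ k ∈ Finset.Icc 1 (p - 1),
      ((w k : ℤ_[p]) : ℚ_[p]) ^ s * (k : ℚ_[p]) ^ zeroSeq p r) atTop
      (𝓝 (∑ k ∈ Finset.Icc 1 (p - 1), ((w k : ℤ_[p]) : ℚ_[p]) ^ s * 1)) := by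
    refine tendsto_finsetSum _ fun k hk => Tendsto.const_mul _ ?_
    rw [Finset.mem_Icc] at hk
    have hk' : ¬ (p : ℤ) ∣ (k : ℤ) := by
      rw [Int.natCast_dvd_natCast]
      exact Nat.not_dvd_of_pos_of_lt (by omega) (by omega)
    rw [tendsto_iff_norm_sub_tendsto_zero]
    refine squeeze_zero (g := fun r : ℕ => ‖(p : ℚ_[p]) ^ r‖ ) (fun _ => norm_nonneg _)
      (fun r => ?_) (by simpa using (tendsto_natCast_pow_atTop p).norm)
    have h2 := (pow_congr_of_congr p hk' (a := r) (m := 0) (m' := zeroSeq p r)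
      ((Nat.modEq_zero_iff_dvd.2 dvd_rfl).symm)).dvd
    have h3 : ((p : ℤ) ^ r) ∣ (k : ℤ) ^ zeroSeq p r - 1 := by
      rw [pow_zero] at h2
      exact (pow_dvd_pow _ (Nat.le_succ r)).trans h2
    obtain ⟨z, hz⟩ := h3
    have h4 : (k : ℚ_[p]) ^ zeroSeq p r - 1 = (p : ℚ_[p]) ^ r * (z : ℚ_[p]) := by
      exact_mod_cast congrArg (fun q : ℤ => (q : ℚ_[p])) hz
    rw [h4, norm_mul]
    exact mul_le_of_le_one_right (norm_nonneg _) (Padic.norm_int_le_one _)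
  simp only [mul_one] at h1
  refine h1.congr' ?_
  filter_upwards [(tendsto_zeroSeq_atTop p).eventually_ge_atTop (s + 1)] with r hrs
  rw [hr, Finset.sum_insert (by simp), Nat.cast_zero, zero_pow (by omega), zero_add]
  refine Finset.sum_congr rfl fun k hk => ?_
  have h5 : (k : ℚ_[p]) * ((w k : ℤ_[p]) : ℚ_[p]) = 1 := by
    have := congrArg (fun q : ℤ_[p] => (q : ℚ_[p])) (hw k hk)
    push_cast at this
    exact this
  rw [← Nat.sub_add_cancel (show s ≤ zeroSeq p r by omega), pow_add, Nat.add_sub_cancel]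
  rw [mul_comm, mul_assoc, ← mul_pow, h5, one_pow, mul_one]

/-- Power sums of `p / k` agree modulo `p ^ 8` with the limit of a truncated Faulhaber sum. -/
theorem norm_powerSum_sub_le (hp : 7 ≤ p) {w : ℕ → ℤ_[p]}
    (hw : ∀ k ∈ Finset.Icc 1 (p - 1), (k : ℤ_[p]) * w k = 1) {s : ℕ} (hs : 2 ≤ s) {L : ℚ_[p]}
    (hL : Tendsto (fun r => ∑ t ∈ Finset.range (8 - s), faulhaberTerm p s (zeroSeq p r) t) atTop
      (𝓝 L)) :
    ‖((∑ k ∈ Finset.Icc 1 (p - 1), (p * w k) ^ s : ℤ_[p]) : ℚ_[p]) - L‖ ≤ ((p : ℝ)⁻¹) ^ 8 := by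
  have h1 := ((tendsto_sum_range_pow p hw s).const_mul ((p : ℚ_[p]) ^ s)).sub hL
  have h2 : ((∑ k ∈ Finset.Icc 1 (p - 1), (p * w k) ^ s : ℤ_[p]) : ℚ_[p]) =
      (p : ℚ_[p]) ^ s * ∑ k ∈ Finset.Icc 1 (p - 1), ((w k : ℤ_[p]) : ℚ_[p]) ^ s := by
    rw [Finset.mul_sum, PadicInt.coe_sum]
    refine Finset.sum_congr rfl fun k _ => ?_
    push_cast
    ring
  rw [h2]
  refine le_of_tendsto h1.norm ?_
  filter_upwards [(tendsto_zeroSeq_atTop p).eventually_ge_atTop (s + 8)] with r hr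
  rw [mul_sum_range_pow_eq, ← Finset.sum_range_add_sum_Ico _ (show 8 - s ≤ zeroSeq p r - s + 1 by omega),
    add_sub_cancel_left]
  refine IsUltrametricDist.norm_sum_le_of_forall_le_of_nonneg (by positivity) fun t ht => ?_
  rw [Finset.mem_Ico] at ht
  exact norm_faulhaberTerm_le p hp hs (by omega) (by omega)

theorem faulhaberTerm_eq_zero {s t r : ℕ} (hp : p ≠ 2) (hs : Even s) (ht : Odd t)
    (h : s + t + 1 < zeroSeq p r) : faulhaberTerm p s (zeroSeq p r) t = 0 := by
  have : Odd (zeroSeq p r - s - t) :=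
    Nat.Even.sub_odd (by omega) ((even_zeroSeq p hp r).tsub hs) ht
  rw [faulhaberTerm, bernoulli_eq_zero_of_odd this (by omega)]
  simp

theorem tendsto_faulhaberTerm (hp : p ≠ 2) {s t : ℕ} (hs : Even s) (ht : Even t)
    (hst : ¬ p ∣ s + t) {χ : ℚ_[p]}
    (hχ : Tendsto (fun r => (((zeroSeq p r - s).choose t : ℕ) : ℚ_[p])) atTop (𝓝 χ)) :
    Tendsto (fun r => faulhaberTerm p s (zeroSeq p r) t) atTop
      (𝓝 ((p : ℚ_[p]) ^ s * (((s + t : ℕ) : ℚ_[p]) * padicZeta p ((s + t : ℕ) + 1) * χ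
        * (p : ℚ_[p]) ^ (t + 1) / (t + 1)))) := by
  have h := tendsto_bernoulli_zeroSeq_sub p hp (hs.add ht) hst
  simp only [faulhaberTerm, Nat.sub_sub]
  exact (((h.mul hχ).mul_const _).div_const _).const_mul _

/-- The binomial coefficient is a polynomial in its upper entry, which tends to `-s`; the limit is
`C(-s, t)`. -/
theorem tendsto_choose_zeroSeq_sub (s t : ℕ) :
    Tendsto (fun r => (((zeroSeq p r - s).choose t : ℕ) : ℚ_[p])) atTop
      (𝓝 ((-1) ^ t * (s.ascFactorial t : ℚ_[p]) / t.factorial)) := by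
  induction t with
  | zero => simp
  | succ t ih =>
    have h1 := ((ih.mul (((tendsto_natCast_zeroSeq p).sub_const (s : ℚ_[p])).sub_const
      (t : ℚ_[p]))).div_const ((t : ℚ_[p]) + 1))
    have ht : (t : ℚ_[p]) + 1 ≠ 0 := by exact_mod_cast Nat.succ_ne_zero t
    have hf : (t.factorial : ℚ_[p]) ≠ 0 := by exact_mod_cast Nat.factorial_ne_zero t
    have e : ((-1) ^ t * (s.ascFactorial t : ℚ_[p]) / t.factorial) * (0 - s - t) / (t + 1) =
        (-1) ^ (t + 1) * (s.ascFactorial (t + 1) : ℚ_[p]) / (t + 1).factorial := by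
      rw [Nat.ascFactorial_succ, Nat.factorial_succ]
      push_cast
      field_simp
      ring
    rw [← e]
    refine h1.congr' ?_
    filter_upwards [(tendsto_zeroSeq_atTop p).eventually_ge_atTop (s + t)] with r hr
    have h2 := Nat.choose_succ_right_eq (zeroSeq p r - s) t
    have h3 : (((zeroSeq p r - s).choose (t + 1) : ℕ) : ℚ_[p]) * (t + 1) =
        ((zeroSeq p r - s).choose t : ℕ) * ((zeroSeq p r : ℚ_[p]) - s - t) := by
      have h4 : ((zeroSeq p r - s - t : ℕ) : ℚ_[p]) = (zeroSeq p r : ℚ_[p]) - s - t := by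
        rw [Nat.cast_sub (by omega), Nat.cast_sub (by omega)]
      rw [← h4]
      exact_mod_cast h2
    rw [← h3]
    field_simp

end HarmonicSums

/-! ### Substitution of zeta values and conclusion -/

section Main

variable (p : ℕ) [Fact p.Prime]

theorem tendsto_sum_faulhaberTerm (hp : 7 ≤ p) {s : ℕ} (hs : Even s) (hs2 : 2 ≤ s) :
    Tendsto (fun r => ∑ t ∈ Finset.range (8 - s), faulhaberTerm p s (zeroSeq p r) t) atTop
      (𝓝 (∑ t ∈ Finset.range (8 - s), if Even t then
        (p : ℚ_[p]) ^ s * (((s + t : ℕ) : ℚ_[p]) * padicZeta p ((s + t : ℕ) + 1) *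
          ((-1) ^ t * (s.ascFactorial t : ℚ_[p]) / t.factorial) * (p : ℚ_[p]) ^ (t + 1) / (t + 1))
        else 0)) := by
  refine tendsto_finsetSum _ fun t ht => ?_
  rw [Finset.mem_range] at ht
  split_ifs with h
  · refine tendsto_faulhaberTerm p (by omega) hs h ?_ (tendsto_choose_zeroSeq_sub p s t)
    have := Nat.even_iff.1 (hs.add h)
    exact Nat.not_dvd_of_pos_of_lt (by omega) (by omega)
  · refine tendsto_const_nhds.congr' ?_
    filter_upwards [(tendsto_zeroSeq_atTop p).eventually_ge_atTop (s + t + 2)] with r hr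
    exact (faulhaberTerm_eq_zero p (by omega) hs (Nat.not_even_iff_odd.1 h) (by omega)).symm

variable {p}

/-- The power sums of `p / k` of weights two, four and six in terms of `p`-adic zeta values. -/
theorem norm_powerSums_sub_le (hp : 7 ≤ p) {w : ℕ → ℤ_[p]}
    (hw : ∀ k ∈ Finset.Icc 1 (p - 1), (k : ℤ_[p]) * w k = 1) (H : ℕ → ℤ_[p])
    (hH : ∀ s, H s = ∑ k ∈ Finset.Icc 1 (p - 1), (p * w k) ^ s) :
    ‖(H 2 : ℚ_[p]) - (2 * (p ^ 3 * padicZeta p 3) + 4 * (p ^ 5 * padicZeta p 5)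
      + 6 * (p ^ 7 * padicZeta p 7))‖ ≤ ((p : ℝ)⁻¹) ^ 8 ∧
    ‖(H 4 : ℚ_[p]) - (4 * (p ^ 5 * padicZeta p 5) + 20 * (p ^ 7 * padicZeta p 7))‖ ≤
      ((p : ℝ)⁻¹) ^ 8 ∧
    ‖(H 6 : ℚ_[p]) - 6 * (p ^ 7 * padicZeta p 7)‖ ≤ ((p : ℝ)⁻¹) ^ 8 := by
  have key : ∀ s, Even s → 2 ≤ s → _ := fun s h1 h2 =>
    norm_powerSum_sub_le p hp hw h2 (tendsto_sum_faulhaberTerm p hp h1 h2)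
  have e1 : ¬ Even 1 := by decide
  have e2 : Even 2 := by decide
  have e3 : ¬ Even 3 := by decide
  have e4 : Even 4 := by decide
  have e5 : ¬ Even 5 := by decide
  refine ⟨?_, ?_, ?_⟩
  · refine (le_of_eq ?_).trans (key 2 (by decide) le_rfl)
    rw [hH]
    congr 2
    norm_num [Finset.sum_range_succ, e1, e2, e3, e4, e5, Nat.ascFactorial, Nat.factorial]
    ring
  · refine (le_of_eq ?_).trans (key 4 (by decide) (by norm_num))
    rw [hH]
    congr 2
    norm_num [Finset.sum_range_succ, e1, e2, e3, Nat.ascFactorial, Nat.factorial]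
    ring
  · refine (le_of_eq ?_).trans (key 6 (by decide) (by norm_num))
    rw [hH]
    congr 2
    norm_num [Finset.sum_range_succ, e1, Nat.ascFactorial, Nat.factorial]
    ring

theorem norm_coe_le_of_pow_dvd {x : ℤ_[p]} {n : ℕ} (h : (p : ℤ_[p]) ^ n ∣ x) :
    ‖(x : ℚ_[p])‖ ≤ ((p : ℝ)⁻¹) ^ n := by
  obtain ⟨z, rfl⟩ := h
  push_cast
  rw [norm_mul, norm_pow, Padic.norm_p]
  exact mul_le_of_le_one_right (by positivity) z.2

theorem padicCongr_of_norm_le {n : ℕ} {x y : ℚ_[p]} (h : ‖x - y‖ ≤ ((p : ℝ)⁻¹) ^ n) :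
    PadicCongr p n x y := by
  have hp : (0 : ℝ) < p := by exact_mod_cast (Fact.out : p.Prime).pos
  have hp0 := pow_ne_zero n (padic_natCast_ne_zero p)
  refine ⟨⟨(x - y) / (p : ℚ_[p]) ^ n, ?_⟩, ?_⟩
  · rw [norm_div, norm_pow, Padic.norm_p]
    exact div_le_one_of_le₀ h (by positivity)
  · change x - y = (p : ℚ_[p]) ^ n * ((x - y) / (p : ℚ_[p]) ^ n)
    field_simp

theorem norm_natCast_eq_one_of_lt {n : ℕ} (h0 : n ≠ 0) (h : n < p) : ‖(n : ℚ_[p])‖ = 1 :=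
  Padic.norm_natCast_eq_one_iff.2
    (Nat.coprime_of_lt_prime h0 h (Fact.out : p.Prime))

/-- Elimination of the power sums in favour of zeta values. -/
theorem norm_sub_le_of_powerSums (hp : 7 ≤ p) {b h2 h4 h6 z3 z5 z7 : ℚ_[p]}
    (hb : ‖b - (1 + h2 - 5 * h4 - h6 + h2 ^ 2)‖ ≤ ((p : ℝ)⁻¹) ^ 8)
    (k2 : ‖h2 - (2 * z3 + 4 * z5 + 6 * z7)‖ ≤ ((p : ℝ)⁻¹) ^ 8)
    (k4 : ‖h4 - (4 * z5 + 20 * z7)‖ ≤ ((p : ℝ)⁻¹) ^ 8)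
    (k6 : ‖h6 - 6 * z7‖ ≤ ((p : ℝ)⁻¹) ^ 8)
    (n2 : ‖h2‖ ≤ ((p : ℝ)⁻¹) ^ 3) (n4 : ‖h4‖ ≤ ((p : ℝ)⁻¹) ^ 5)
    (n6 : ‖h6‖ ≤ ((p : ℝ)⁻¹) ^ 6) :
    ‖b - (1 + 2 * z3 - 16 * z5 + 4 * z3 ^ 2 - 100 * z7)‖ ≤ ((p : ℝ)⁻¹) ^ 8 := by
  have hp0 : (0 : ℝ) < p := by exact_mod_cast (Fact.out : p.Prime).pos
  have hp1 : (p : ℝ)⁻¹ ≤ 1 :=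
    inv_le_one_of_one_le₀ (by exact_mod_cast (Fact.out : p.Prime).one_lt.le)
  have hpos : (0 : ℝ) ≤ (p : ℝ)⁻¹ := by positivity
  have mono : ∀ {a c : ℕ}, c ≤ a → ((p : ℝ)⁻¹) ^ a ≤ ((p : ℝ)⁻¹) ^ c := fun h =>
    pow_le_pow_of_le_one hpos hp1 h
  have add : ∀ {x y : ℚ_[p]} {e : ℝ}, ‖x‖ ≤ e → ‖y‖ ≤ e → ‖x + y‖ ≤ e := fun hx hy =>
    (Padic.nonarchimedean _ _).trans (max_le hx hy)
  have sub : ∀ {x y : ℚ_[p]} {e : ℝ}, ‖x‖ ≤ e → ‖y‖ ≤ e → ‖x - y‖ ≤ e := fun hx hy => by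
    rw [sub_eq_add_neg]; exact add hx (by rwa [norm_neg])
  have int : ∀ (n : ℤ) {x : ℚ_[p]} {e : ℝ}, ‖x‖ ≤ e → ‖(n : ℚ_[p]) * x‖ ≤ e := fun n x e hx => by
    rw [norm_mul]
    exact (mul_le_of_le_one_left (norm_nonneg _) (Padic.norm_int_le_one n)).trans hx
  have six : ‖(6 : ℚ_[p])‖ = 1 := by
    exact_mod_cast norm_natCast_eq_one_of_lt (p := p) (n := 6) (by norm_num) (by omega)
  have m7 : ‖z7‖ ≤ ((p : ℝ)⁻¹) ^ 6 := by
    have h : ‖6 * z7‖ ≤ ((p : ℝ)⁻¹) ^ 6 := by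
      rw [show 6 * z7 = h6 - (h6 - 6 * z7) by ring]
      exact sub n6 (k6.trans (mono (by norm_num)))
    rwa [norm_mul, six, one_mul] at h
  -- Modulo `p ^ 8` the difference is `4 * z5 + 6 * z7 = (4 * z5 + 20 * z7) - 14 * z7`, that is, `h4
  -- - 14 * z7`. The bound `p ^ 5`, together with `p ^ 3` for `h2 + 2 * z3`, allows `h2 ^ 2` to be
  -- replaced by `4 * z3 ^ 2`.
  have d : ‖h2 - 2 * z3‖ ≤ ((p : ℝ)⁻¹) ^ 5 := by
    rw [show h2 - 2 * z3 = (h2 - (2 * z3 + 4 * z5 + 6 * z7)) + (h4 - (h4 - (4 * z5 + 20 * z7)))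
      + ((-14 : ℤ) : ℚ_[p]) * z7 by push_cast; ring]
    exact add (add (k2.trans (mono (by norm_num))) (sub n4 (k4.trans (mono (by norm_num)))))
      (int _ (m7.trans (mono (by norm_num))))
  have m : ‖h2 + 2 * z3‖ ≤ ((p : ℝ)⁻¹) ^ 3 := by
    rw [show h2 + 2 * z3 = ((2 : ℤ) : ℚ_[p]) * h2 - (h2 - 2 * z3) by push_cast; ring]
    exact sub (int _ n2) (d.trans (mono (by norm_num)))
  have dm : ‖(h2 - 2 * z3) * (h2 + 2 * z3)‖ ≤ ((p : ℝ)⁻¹) ^ 8 := by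
    rw [norm_mul, show 8 = 5 + 3 by norm_num, pow_add]
    exact mul_le_mul d m (norm_nonneg _) (by positivity)
  rw [show b - (1 + 2 * z3 - 16 * z5 + 4 * z3 ^ 2 - 100 * z7) =
    (b - (1 + h2 - 5 * h4 - h6 + h2 ^ 2)) + (h2 - (2 * z3 + 4 * z5 + 6 * z7))
    - ((5 : ℤ) : ℚ_[p]) * (h4 - (4 * z5 + 20 * z7)) - (h6 - 6 * z7)
    + (h2 - 2 * z3) * (h2 + 2 * z3) by push_cast; ring]
  exact add (sub (sub (add hb k2) (int _ k4)) k6) dm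

end Main

theorem mainTheorem7 (p : ℕ) [Fact p.Prime] (hp : 7 ≤ p) :
    (∀ k ∈ ({3, 5, 7} : Set ℤ),
      Tendsto (eulerRemovedZeta p) (padicZetaFilter p k) (𝓝 (padicZeta p k))) ∧
    PadicCongr p 8 ((aperyB (p - 1) : ℚ) : ℚ_[p])
      (1 + 2 * (p : ℚ_[p]) ^ 3 * padicZeta p 3
        - 16 * (p : ℚ_[p]) ^ 5 * padicZeta p 5
        + 4 * (p : ℚ_[p]) ^ 6 * padicZeta p 3 ^ 2
        - 100 * (p : ℚ_[p]) ^ 7 * padicZeta p 7) := by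
  refine ⟨fun k hk => ?_, ?_⟩
  · have h : k = 3 ∨ k = 5 ∨ k = 7 := by simpa using hk
    refine tendsto_padicZeta p (by omega) ?_ fun hd => ?_
    · rcases h with rfl | rfl | rfl <;> decide
    · have := Int.le_of_dvd (by omega) hd
      omega
  · obtain ⟨w, hw⟩ := exists_padicInt_inverse p
    set H : ℕ → ℤ_[p] := fun s => ∑ k ∈ Finset.Icc 1 (p - 1), (p * w k) ^ s with hH
    have hb := norm_coe_le_of_pow_dvd (sum_aperyTerm_sq_congr hp hw H fun _ => rfl)
    obtain ⟨k2, k4, k6⟩ := norm_powerSums_sub_le hp hw H fun _ => rfl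
    have hdvd : ∀ s, s ≠ 0 → s < p - 1 → (p : ℤ_[p]) ^ (s + 1) ∣ H s := fun s hs hs' => by
      simp only [hH, mul_pow, ← Finset.mul_sum, pow_succ (p : ℤ_[p]) s]
      exact mul_dvd_mul_left _ (dvd_sum_inverse_pow hw hs hs')
    -- For `p = 7` the exponent `6` equals `p - 1`, so the extra factor `p` is not available; the
    -- trivial divisibility is enough.
    have hdvd6 : (p : ℤ_[p]) ^ 6 ∣ H 6 := Finset.dvd_sum fun k _ => by
      rw [mul_pow]; exact dvd_mul_right _ _
    have hB : ((aperyB (p - 1) : ℚ) : ℚ_[p]) =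
        ((∑ k ∈ Finset.range p, (aperyTerm (p - 1) k : ℤ_[p]) ^ 2 : ℤ_[p]) : ℚ_[p]) := by
      rw [aperyB_eq_sum, Nat.sub_add_cancel (by omega), PadicInt.coe_sum]
      push_cast
      rfl
    have key := norm_sub_le_of_powerSums hp (b := ((aperyB (p - 1) : ℚ) : ℚ_[p]))
      (by rw [hB]; push_cast at hb ⊢; exact hb) k2 k4 k6
      (norm_coe_le_of_pow_dvd (hdvd 2 (by norm_num) (by omega)))
      (norm_coe_le_of_pow_dvd (hdvd 4 (by norm_num) (by omega)))
      (norm_coe_le_of_pow_dvd hdvd6)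
    refine padicCongr_of_norm_le ?_
    refine (le_of_eq ?_).trans key
    congr 1
    ring
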